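/- **Parameters.** Let $N_1\ge N_2\ge 1$ be integers (numbers of antennas of each macro and each pico base station), let $\lambda_1,\lambda_2,\lambda_u>0$ (densities of macro base stations, pico base stations and users), $P_1>P_2>0$ (powers), $\alpha_1,\alpha_2>2$ (path loss exponents), $\rho_1,\rho_2>0$ (transmit signal-to-noise ratios), $B>1$ (bias factor) and $W>0$ (resource). **User types.** Let $Z_1,Z_2$ be independent, $Z_j$ with density $2\pi\lambda_j r e^{-\pi\lambda_j r^2}$ on $(0,\infty)$ (distance of the typical user to the nearest base station of tier $j$, the tiers being Poisson processes). Put $\mathcal A_1=\Pr(P_1Z_1^{-\alpha_1}\ge BP_2Z_2^{-\alpha_2})$, $\mathcal A_{2\bar O}=\Pr(P_2Z_2^{-\alpha_2}>P_1Z_1^{-\alpha_1})$, $\mathcal A_{2O}=\Pr(P_2Z_2^{-\alpha_2}\le P_1Z_1^{-\alpha_1}<BP_2Z_2^{-\alpha_2})$, $\mathcal A_2=\mathcal A_{2O}+\mathcal A_{2\bar O}$, and $$f_{Y_1}(y)=\tfrac{2\pi\lambda_1}{\mathcal A_1}\,y\,e^{-\pi\left(\lambda_1y^2+\lambda_2(P_2B/P_1)^{2/\alpha_2}y^{2\alpha_1/\alpha_2}\right)},\qquad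 f_{Y_2}(y)=\tfrac{2\pi\lambda_2}{\mathcal A_{2\bar O}}\,y\,e^{-\pi\left(\lambda_1(P_1/P_2)^{2/\alpha_1}y^{2\alpha_2/\alpha_1}+\lambda_2y^2\right)},$$ $$f_{Y_1,Y_2}(x,y)=\tfrac{4\pi^2\lambda_1\lambda_2}{\mathcal A_{2O}}\,x\,y\,e^{-\pi(\lambda_1x^2+\lambda_2y^2)}.$$ **Interference nulling.** Let $c=\frac{\lambda_2\mathcal A_{2O}}{\mathcal A_2\lambda_1}$, $$p(n)=\frac{3.5^{3.5}\,\Gamma(n+3.5)}{\Gamma(3.5)\,n!}\,c^n(3.5+c)^{-(n+3.5)}\ (n\ge0),\qquad \hat p(n)=\frac{3.5^{3.5}\,\Gamma(n+3.5)}{\Gamma(n)\,\Gamma(3.5)}\,c^{n-1}(3.5+c)^{-(n+3.5)}\ (n\ge1).$$ For $U\in\{0,\dots,N_1-1\}$ let $p_U(n)=p(n)$ for $0\le n<U$ and $p_U(U)=\sum_{u\ge U}p(u)$, and let the probability that an offloaded user is selected for interference nulling be $$q_U=\frac Uc\Big(1-\big(1+\tfrac{c}{3.5}\big)^{-3.5}\Big)-\sum_{n=1}^U\frac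 Un\,\hat p(n)+\sum_{n=1}^U\hat p(n).$$ **Coverage.** Let $B'(a,b,z)=\int_z^1u^{a-1}(1-u)^{b-1}\,du$, let $$\mathcal L_j(s,r)=\exp\Big(-\tfrac{2\pi\lambda_j}{\alpha_j}s^{2/\alpha_j}B'\big(\tfrac2{\alpha_j},1-\tfrac2{\alpha_j},\tfrac1{1+sr^{-\alpha_j}}\big)\Big),$$ and let $\mathcal L_j^{(m)}(s,r)=\mathcal L_j(s,r)\sum\frac{m!}{\prod_{a=1}^m p_a!}\prod_{a=1}^m\Big(\frac{2\pi}{\alpha_j}\lambda_js^{2/\alpha_j}B'\big(1+\frac2{\alpha_j},a-\frac2{\alpha_j},\frac1{1+sr^{-\alpha_j}}\big)\Big)^{p_a}$, where the sum is over all tuples $(p_1,\dots,p_m)$ of nonnegative integers with $\sum_a a\,p_a=m$. For $\beta>0$ and $U\in\{0,\dots,N_1-1\}$ put $$\mathcal S_1(U,\beta)=\sum_{u=0}^{U}p_U(u)\int_0^\infty\sum_{n=0}^{N_1-u-1}\frac1{n!}\sum_{k=0}^n\binom nk\mathcal L_1^{(k)}\big(\beta y^{\alpha_1},y\big)\,\mathcal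 L_2^{(n-k)}\Big(\beta y^{\alpha_1}\tfrac{\rho_2}{\rho_1},\big(\tfrac{P_2B}{P_1}\big)^{\frac1{\alpha_2}}y^{\frac{\alpha_1}{\alpha_2}}\Big)f_{Y_1}(y)\,dy,$$ $$\mathcal S_{2\bar O}(\beta)=\int_0^\infty\sum_{n=0}^{N_2-1}\frac1{n!}\sum_{k=0}^n\binom nk\mathcal L_1^{(k)}\Big(\beta y^{\alpha_2}\tfrac{\rho_1}{\rho_2},\big(\tfrac{P_1}{P_2}\big)^{\frac1{\alpha_1}}y^{\frac{\alpha_2}{\alpha_1}}\Big)\,\mathcal L_2^{(n-k)}\big(\beta y^{\alpha_2},y\big)f_{Y_2}(y)\,dy.$$ With the abbreviation $L_1^{(k)}=\mathcal L_1^{(k)}\big(\beta y^{\alpha_2}\frac{\rho_1}{\rho_2},x\big)$, $L_2^{(k)}=\mathcal L_2^{(k)}\big(\beta y^{\alpha_2},y\big)$, $t=\beta\frac{\rho_1y^{\alpha_2}}{\rho_2x^{\alpha_1}}$, and $\int_{\mathcal O}$ for the integral over $x>0$, $\big(\frac{P_2}{P_1}\big)^{\frac1{\alpha_2}}x^{\frac{\alpha_1}{\alpha_2}}<y<\big(\frac{BP_2}{P_1}\big)^{\frac1{\alpha_2}}x^{\frac{\alpha_1}{\alpha_2}}$,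 put $$\mathcal S_{2OC}(\beta)=\int_{\mathcal O}\sum_{n=0}^{N_2-1}\frac1{n!}\sum_{k=0}^n\binom nkL_1^{(k)}L_2^{(n-k)}f_{Y_1,Y_2}(x,y)\,dy\,dx,$$ $$\mathcal S_{2O\bar C}(\beta)=\int_{\mathcal O}\sum_{n=0}^{N_2-1}\frac1{n!}\sum_{q_1+q_2+q_3=n}\binom n{q_1,q_2,q_3}L_1^{(q_1)}L_2^{(q_2)}\,q_3!\,t^{q_3}(1+t)^{-(q_3+1)}f_{Y_1,Y_2}(x,y)\,dy\,dx.$$ **Objective.** Let $\ell_1=1+1.28\frac{\lambda_u\mathcal A_1}{\lambda_1}$ and $\ell_2=1+1.28\frac{\lambda_u\mathcal A_2}{\lambda_2}$ (mean loads), and $\beta_j(\tau)=2^{\ell_j\tau/W}-1$. The rate coverage probability with mean load approximation, at rate threshold $\tau>0$, is $$\bar{\mathcal R}(U,\tau)=\mathcal A_1\mathcal S_1(U,\beta_1(\tau))+\mathcal A_{2\bar O}\mathcal S_{2\bar O}(\beta_2(\tau))+\mathcal A_{2O}\,q_U\,\mathcal S_{2OC}(\beta_2(\tau))+\mathcal A_{2O}(1-q_U)\,\mathcal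 S_{2O\bar C}(\beta_2(\tau)).$$ Let $U^*(\tau)=\arg\max_{U\in\{0,\dots,N_1-1\}}\bar{\mathcal R}(U,\tau)$, where the smallest maximizer is taken if there are several. **Theorem.** There is a fixed value $U_0^*\in\{N_1-N_2-1,\,N_1-N_2\}$ such that $U^*(\tau)\to U_0^*$ as $\tau\to0^+$ (that is, $U^*(\tau)=U_0^*$ for all sufficiently small $\tau>0$). Moreover, for all sufficiently small $\tau>0$ the set of all maximizers of $\bar{\mathcal R}(\cdot,\tau)$ is one and the same subset of $\{N_1-N_2-1,\,N_1-N_2\}$. -/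

import Mathlib

open MeasureTheory Filter Topology

noncomputable section

namespace HetNet

/-- Parameters of a downlink two-tier network. Index `1` is the macro tier, index `2` the pico
tier: numbers of antennas `N`, densities `lam` of the base stations (`lamu`: of the users),
transmission powers `P`, path loss exponents `alpha`, transmit signal-to-noise ratios `rho`;
`B` is the bias factor and `W` the available resource. -/
structure Params where
  N1 : ℕ
  N2 : ℕ
  lam1 : ℝ
  lam2 : ℝ
  lamu : ℝ
  P1 : ℝ
  P2 : ℝ
  alpha1 : ℝ
  alpha2 : ℝ
  rho1 : ℝ
  rho2 : ℝ
  B : ℝ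
  W : ℝ
  N1_pos : 0 < N1
  N2_pos : 0 < N2
  lam1_pos : 0 < lam1
  lam2_pos : 0 < lam2
  lamu_pos : 0 < lamu
  P2_pos : 0 < P2
  P2_lt_P1 : P2 < P1
  two_lt_alpha1 : 2 < alpha1
  two_lt_alpha2 : 2 < alpha2
  rho1_pos : 0 < rho1
  rho2_pos : 0 < rho2
  one_lt_B : 1 < B
  W_pos : 0 < W

/-! ### Functions that do not depend on the network -/

/-- The complementary incomplete beta function `B'(a,b,z) = ∫_z^1 u^(a-1) (1-u)^(b-1) du`. -/
def betaInc (a b z : ℝ) : ℝ := ∫ u in z..1, u ^ (a - 1) * (1 - u) ^ (b - 1)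

/-- Laplace transform, at `s`, of the interference (Rayleigh fading, path loss exponent `alpha`)
from a Poisson field of density `lam` outside the disc of radius `r`. -/
def laplace (lam alpha s r : ℝ) : ℝ :=
  Real.exp (-(2 * Real.pi * lam / alpha * s ^ (2 / alpha) *
    betaInc (2 / alpha) (1 - 2 / alpha) (1 / (1 + s * r ^ (-alpha)))))

/-- The tuples `(p_1, …, p_m)` of natural numbers with `∑ a * p_a = m`. The entry `p_a` has
index `a - 1` in `Fin m`. -/
def weightedTuples (m : ℕ) : Finset (Fin m → ℕ) :=
  (Fintype.piFinset fun _ : Fin m => Finset.range (m + 1)).filter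
    fun p => ∑ a : Fin m, ((a : ℕ) + 1) * p a = m

theorem mem_weightedTuples {m : ℕ} {p : Fin m → ℕ} :
    p ∈ weightedTuples m ↔ ∑ a : Fin m, ((a : ℕ) + 1) * p a = m := by
  unfold weightedTuples
  rw [Finset.mem_filter, and_iff_right_iff_imp]
  intro h
  rw [Fintype.mem_piFinset]
  intro a
  rw [Finset.mem_range, Nat.lt_succ_iff]
  calc p a ≤ ((a : ℕ) + 1) * p a := Nat.le_mul_of_pos_left _ (Nat.succ_pos _)
    _ ≤ ∑ b : Fin m, ((b : ℕ) + 1) * p b :=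
        Finset.single_le_sum (f := fun b : Fin m => ((b : ℕ) + 1) * p b)
          (fun _ _ => Nat.zero_le _) (Finset.mem_univ a)
    _ = m := h

/-- The scaled derivative `(-s)^m (d/ds)^m` of `laplace`, in explicit form. -/
def laplaceD (lam alpha : ℝ) (m : ℕ) (s r : ℝ) : ℝ :=
  laplace lam alpha s r *
    ∑ p ∈ weightedTuples m,
      ((m.factorial : ℝ) / ∏ a : Fin m, ((p a).factorial : ℝ)) *
        ∏ a : Fin m,
          (2 * Real.pi / alpha * lam * s ^ (2 / alpha) *
            betaInc (1 + 2 / alpha) (((a : ℕ) : ℝ) + 1 - 2 / alpha)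
              (1 / (1 + s * r ^ (-alpha)))) ^ p a

/-- `f(x) = 2^x - 1`. -/
def rateToSIR (x : ℝ) : ℝ := (2 : ℝ) ^ x - 1

/-- Law of the distance from the origin to the nearest point of a planar homogeneous Poisson
point process of density `lam`: density `2 π lam r exp(-π lam r^2)` on `(0, ∞)`. -/
def nearestDistLaw (lam : ℝ) : Measure ℝ :=
  (volume.restrict (Set.Ioi 0)).withDensity fun r =>
    ENNReal.ofReal (2 * Real.pi * lam * r * Real.exp (-(Real.pi * lam * r ^ 2)))

namespace Params

variable (H : Params)

/-! ### User association -/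

/-- Joint law of the distances `(Z_1, Z_2)` of the typical user to the nearest macro base station
and the nearest pico base station. -/
def distLaw : Measure (ℝ × ℝ) := (nearestDistLaw H.lam1).prod (nearestDistLaw H.lam2)

/-- `A_1`: probability that the typical user is a macro-user. -/
def A1 : ℝ := H.distLaw.real
  {z | H.B * H.P2 * z.2 ^ (-H.alpha2) ≤ H.P1 * z.1 ^ (-H.alpha1)}

/-- Probability that the typical user is an unoffloaded pico-user. -/
def A2Obar : ℝ := H.distLaw.real
  {z | H.P1 * z.1 ^ (-H.alpha1) < H.P2 * z.2 ^ (-H.alpha2)}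

/-- `A_{2O}`: probability that the typical user is an offloaded user. -/
def A2O : ℝ := H.distLaw.real
  {z | H.P2 * z.2 ^ (-H.alpha2) ≤ H.P1 * z.1 ^ (-H.alpha1) ∧
    H.P1 * z.1 ^ (-H.alpha1) < H.B * H.P2 * z.2 ^ (-H.alpha2)}

/-- `A_2`: probability that the typical user is a pico-user. -/
def A2 : ℝ := H.A2O + H.A2Obar

/-- Density of the distance to the serving base station, given a macro-user. -/
def fY1 (y : ℝ) : ℝ :=
  2 * Real.pi * H.lam1 / H.A1 * y *
    Real.exp (-Real.pi * (H.lam1 * y ^ 2 +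
      H.lam2 * (H.P2 * H.B / H.P1) ^ (2 / H.alpha2) * y ^ (2 * H.alpha1 / H.alpha2)))

/-- Density of the distance to the serving base station, given an unoffloaded pico-user. -/
def fY2 (y : ℝ) : ℝ :=
  2 * Real.pi * H.lam2 / H.A2Obar * y *
    Real.exp (-Real.pi * (H.lam1 * (H.P1 / H.P2) ^ (2 / H.alpha1) *
      y ^ (2 * H.alpha2 / H.alpha1) + H.lam2 * y ^ 2))

/-- Joint density of the distances `(x, y)` to the nearest macro and pico base stations, given an
offloaded user. It is only evaluated on the region that describes the offloaded users. -/
def fY12 (x y : ℝ) : ℝ :=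
  4 * Real.pi ^ 2 * H.lam1 * H.lam2 / H.A2O * x * y *
    Real.exp (-Real.pi * (H.lam1 * x ^ 2 + H.lam2 * y ^ 2))

/-! ### Interference nulling -/

/-- `λ_2 A_{2O} / (A_2 λ_1)`: mean number of active offloaded users of a macro base station. -/
def meanActive : ℝ := H.lam2 * H.A2O / (H.A2 * H.lam1)

/-- Probability mass function of the number of active offloaded users of the serving macro base
station of a macro-user (`n ≥ 0`). -/
def pmfActive (n : ℕ) : ℝ :=
  (3.5 : ℝ) ^ (3.5 : ℝ) * Real.Gamma (n + 3.5) / (Real.Gamma 3.5 * n.factorial) *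
    H.meanActive ^ n * (3.5 + H.meanActive) ^ (-((n : ℝ) + 3.5))

/-- Probability mass function of the number of active offloaded users of the nearest macro base
station of an offloaded user (`n ≥ 1`). -/
def pmfActiveHat (n : ℕ) : ℝ :=
  (3.5 : ℝ) ^ (3.5 : ℝ) * Real.Gamma (n + 3.5) / (Real.Gamma n * Real.Gamma 3.5) *
    H.meanActive ^ (n - 1) * (3.5 + H.meanActive) ^ (-((n : ℝ) + 3.5))

/-- Probability mass function of the number of degrees of freedom used for interference nulling at
the serving macro base station of a macro-user, that is, of the minimum of `U` and the number of
active offloaded users (`0 ≤ n ≤ U`). -/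
def pmfNulled (U n : ℕ) : ℝ :=
  if n < U then H.pmfActive n else ∑' k : ℕ, H.pmfActive (n + k)

/-- Probability that an offloaded user is selected for interference nulling. -/
def prSelected (U : ℕ) : ℝ :=
  U * H.lam1 * H.A2 / (H.lam2 * H.A2O) *
      (1 - (1 + H.lam2 * H.A2O / (3.5 * H.lam1 * H.A2)) ^ (-(3.5 : ℝ)))
    - ∑ n ∈ Finset.Icc 1 U, (U : ℝ) / n * H.pmfActiveHat n
    + ∑ n ∈ Finset.Icc 1 U, H.pmfActiveHat n

/-! ### SIR coverage probabilities -/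

/-- Coverage probability of a macro-user. -/
def S1 (U : ℕ) (β : ℝ) : ℝ :=
  ∑ u ∈ Finset.range (U + 1),
    (∫ y in Set.Ioi (0 : ℝ),
      (∑ n ∈ Finset.range (H.N1 - u), 1 / (n.factorial : ℝ) *
        ∑ k ∈ Finset.range (n + 1), (n.choose k : ℝ) *
          laplaceD H.lam1 H.alpha1 k (β * y ^ H.alpha1) y *
          laplaceD H.lam2 H.alpha2 (n - k) (β * y ^ H.alpha1 * (H.rho2 / H.rho1))
            ((H.P2 * H.B / H.P1) ^ (1 / H.alpha2) * y ^ (H.alpha1 / H.alpha2))) *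
        H.fY1 y) * H.pmfNulled U u

/-- Coverage probability of an unoffloaded pico-user. -/
def S2Obar (β : ℝ) : ℝ :=
  ∫ y in Set.Ioi (0 : ℝ),
    (∑ n ∈ Finset.range H.N2, 1 / (n.factorial : ℝ) *
      ∑ k ∈ Finset.range (n + 1), (n.choose k : ℝ) *
        laplaceD H.lam1 H.alpha1 k (β * y ^ H.alpha2 * (H.rho1 / H.rho2))
          ((H.P1 / H.P2) ^ (1 / H.alpha1) * y ^ (H.alpha2 / H.alpha1)) *
        laplaceD H.lam2 H.alpha2 (n - k) (β * y ^ H.alpha2) y) *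
      H.fY2 y

/-- Offloaded users at distance `x` from the nearest macro base station have their nearest pico
base station at a distance between `offLower x` and `offUpper x`. -/
def offLower (x : ℝ) : ℝ := (H.P2 / H.P1) ^ (1 / H.alpha2) * x ^ (H.alpha1 / H.alpha2)

/-- See `offLower`. -/
def offUpper (x : ℝ) : ℝ := (H.B * H.P2 / H.P1) ^ (1 / H.alpha2) * x ^ (H.alpha1 / H.alpha2)

/-- Coverage probability of an offloaded user that is selected for interference nulling. -/
def S2OC (β : ℝ) : ℝ :=
  ∫ x in Set.Ioi (0 : ℝ), ∫ y in (H.offLower x)..(H.offUpper x),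
    (∑ n ∈ Finset.range H.N2, 1 / (n.factorial : ℝ) *
      ∑ k ∈ Finset.range (n + 1), (n.choose k : ℝ) *
        laplaceD H.lam1 H.alpha1 k (β * y ^ H.alpha2 * (H.rho1 / H.rho2)) x *
        laplaceD H.lam2 H.alpha2 (n - k) (β * y ^ H.alpha2) y) *
      H.fY12 x y

/-- Coverage probability of an offloaded user that is not selected for interference nulling. -/
def S2OCbar (β : ℝ) : ℝ :=
  ∫ x in Set.Ioi (0 : ℝ), ∫ y in (H.offLower x)..(H.offUpper x),
    (∑ n ∈ Finset.range H.N2, 1 / (n.factorial : ℝ) *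
      ∑ q ∈ Finset.Nat.antidiagonalTuple 3 n, (Nat.multinomial Finset.univ q : ℝ) *
        laplaceD H.lam1 H.alpha1 (q 0) (β * y ^ H.alpha2 * (H.rho1 / H.rho2)) x *
        laplaceD H.lam2 H.alpha2 (q 1) (β * y ^ H.alpha2) y *
        Real.Gamma (q 2 + 1) *
        (β * (H.rho1 * y ^ H.alpha2 / (H.rho2 * x ^ H.alpha1))) ^ q 2 *
        ((1 + β * (H.rho1 * y ^ H.alpha2 / (H.rho2 * x ^ H.alpha1))) ^ (q 2 + 1))⁻¹) *
      H.fY12 x y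

/-! ### Rate coverage probability with mean load approximation, and its maximizers -/

/-- Mean load of the serving macro base station. -/
def meanLoad1 : ℝ := 1 + 1.28 * (H.lamu * H.A1 / H.lam1)

/-- Mean load of the serving pico base station. -/
def meanLoad2 : ℝ := 1 + 1.28 * (H.lamu * H.A2 / H.lam2)

/-- Rate coverage probability with mean load approximation, for the design parameter `U` and the
rate threshold `τ`. -/
def rateCoverage (U : ℕ) (τ : ℝ) : ℝ :=
  H.A1 * H.S1 U (rateToSIR (H.meanLoad1 * τ / H.W))
  + H.A2Obar * H.S2Obar (rateToSIR (H.meanLoad2 * τ / H.W))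
  + H.A2O * H.prSelected U * H.S2OC (rateToSIR (H.meanLoad2 * τ / H.W))
  + H.A2O * (1 - H.prSelected U) * H.S2OCbar (rateToSIR (H.meanLoad2 * τ / H.W))

/-- The set of all maximizers of `U ↦ rateCoverage U τ` over `{0, …, N1 - 1}`. -/
def argmaxU (τ : ℝ) : Set ℕ :=
  {U | U < H.N1 ∧ ∀ V < H.N1, H.rateCoverage V τ ≤ H.rateCoverage U τ}

/-- The optimal design parameter. If there are several maximizers, it is the smallest one, so
that the increment of the objective is positive at it and nonpositive after it. -/
def optU (τ : ℝ) : ℕ := sInf (H.argmaxU τ)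

end Params

end HetNet

end

/-!
# The optimal number of nulled interferers at low rates

Consider the step from `U` to `U + 1` as the rate threshold `τ`, and with it the SIR thresholds
`β = rateToSIR (ℓ τ / W)`, tends to `0` from the right.

* A macro-user loses one degree of freedom with positive probability, and with it the last summand
  of its coverage probability (`S1_succ_sub`). This summand has exact order `β ^ (N1 - (U + 1))`.
* The selection probability of an offloaded user strictly increases (`prSelected_lt_succ`), because
  the negative binomial weights sum to one. For such a user nulling gains a term of exact order
  `β ^ N2` (`S2OC_sub_S2OCbar`), because the nearest macro base station adds an independent
  geometric variable to the count that has to stay below `N2`.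

So the step is a gain if `N1 - (U + 1) > N2` and a loss if `N1 - (U + 1) < N2`, and the objective is
unimodal with its maximum at `N1 - N2 - 1` or `N1 - N2`. When both orders agree, the leading
coefficients may cancel. The sign of the step is still constant for small `τ > 0`, because the step
is a real analytic function of `τ` at `0` (`eventually_sign_of_analyticAt`): either it vanishes near
`0`, and there are two maximizers, or it has a definite sign.

Analyticity and exact orders come from a substitution in the incomplete beta function
(`betaInc_eq`). With `t = s r ^ (-alpha)` and `v = r ^ 2` it gives
`laplaceD lam alpha m s r = t ^ m * laplaceCore lam alpha m t v` (`laplaceD_eq`): the fractional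
powers of `s` cancel, and `laplaceCore` is holomorphic in `t` near `0`, positive at `t = 0`, and for
`t` near `0` grows in `v` more slowly than any prescribed exponential (`isTame_laplaceCoreC`). In all
coverage integrals `t` is `β` times a bounded function of the positions of the base stations, and
the law of the positions has Gaussian tails, so that integration preserves holomorphy
(`differentiableOn_integral_of_dominated`).
-/

namespace HetNet

/-! ### Holomorphic dependence of an integral on a parameter -/

/-- An integral depends holomorphically on a parameter if the integrand does and is dominated by
an integrable function. Cauchy's estimate supplies the bound on the derivative that
differentiation under the integral sign requires. -/
theorem differentiableOn_integral_of_dominated {Ω : Type*} [MeasurableSpace Ω] {μ : Measure Ω}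
    {F : ℂ → Ω → ℂ} {r : ℝ} {bound : Ω → ℝ}
    (hmeas : ∀ z ∈ Metric.ball (0 : ℂ) r, AEStronglyMeasurable (F z) μ)
    (hdiff : ∀ᵐ ω ∂μ, DifferentiableOn ℂ (fun z => F z ω) (Metric.ball 0 r))
    (hbound : ∀ᵐ ω ∂μ, ∀ z ∈ Metric.ball (0 : ℂ) r, ‖F z ω‖ ≤ bound ω)
    (hint : Integrable bound μ) :
    DifferentiableOn ℂ (fun z => ∫ ω, F z ω ∂μ) (Metric.ball 0 r) := by
  intro z₀ hz₀
  have hz₀' : ‖z₀‖ < r := by simpa using hz₀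
  obtain ⟨d, hd, hdr⟩ : ∃ d : ℝ, 0 < d ∧ ‖z₀‖ + 2 * d ≤ r :=
    ⟨(r - ‖z₀‖) / 2, by linarith, by linarith⟩
  refine (HasDerivAt.differentiableAt (hasDerivAt_integral_of_dominated_loc_of_deriv_le
    (s := Metric.ball z₀ d) (F' := fun z ω => deriv (fun z => F z ω) z)
    (bound := fun ω => bound ω / (d / 2))
    (Metric.ball_mem_nhds _ hd) ?_ ?_ ?_ ?_ (hint.div_const _) ?_).2).differentiableWithinAt
  · filter_upwards [Metric.isOpen_ball.mem_nhds hz₀] with z hz using hmeas z hz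
  · exact hint.mono' (hmeas z₀ hz₀) (hbound.mono fun ω h => h z₀ hz₀)
  · have hu : ∀ n : ℕ, z₀ + ((d / (n + 1) : ℝ) : ℂ) ∈ Metric.ball (0 : ℂ) r := by
      intro n
      have h1 : ‖((d / (n + 1) : ℝ) : ℂ)‖ ≤ d := by
        rw [Complex.norm_real, Real.norm_of_nonneg (by positivity)]
        exact div_le_self hd.le (by linarith [n.cast_nonneg (α := ℝ)])
      have h2 := norm_add_le z₀ ((d / (n + 1) : ℝ) : ℂ)
      rw [mem_ball_zero_iff]
      linarith
    refine aestronglyMeasurable_of_tendsto_ae (u := atTop)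
      (f := fun (n : ℕ) ω => slope (fun z => F z ω) z₀ (z₀ + ((d / (n + 1) : ℝ) : ℂ))) ?_ ?_
    · intro n
      simp only [slope_def_module]
      exact ((hmeas _ (hu n)).sub (hmeas _ hz₀)).const_smul (_ : ℂ)
    · filter_upwards [hdiff] with ω hω
      have h1 := (hω.differentiableAt (Metric.isOpen_ball.mem_nhds hz₀)).hasDerivAt
      rw [hasDerivAt_iff_tendsto_slope] at h1
      refine h1.comp (tendsto_nhdsWithin_iff.2 ⟨?_, Eventually.of_forall fun n => ?_⟩)
      · have h2 : Tendsto (fun n : ℕ => d / ((n : ℝ) + 1)) atTop (𝓝 0) :=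
          tendsto_const_div_atTop_nhds_zero_nat d |>.comp (tendsto_add_atTop_nat 1) |>.congr
            fun n => by simp
        have h3 := (Complex.continuous_ofReal.tendsto 0).comp h2
        simpa using h3.const_add z₀
      · have : (0 : ℝ) < d / (n + 1) := by positivity
        simp only [Set.mem_compl_iff, Set.mem_singleton_iff, add_eq_left, Complex.ofReal_eq_zero]
        exact this.ne'
  · filter_upwards [hdiff, hbound] with ω h1 h2 z hz
    have hsub : Metric.closedBall z (d / 2) ⊆ Metric.ball 0 r := by
      intro w hw
      rw [mem_ball_zero_iff]
      have a1 := mem_ball_iff_norm.1 hz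
      have a2 := mem_closedBall_iff_norm.1 hw
      have a3 := norm_add_le z₀ (z - z₀)
      have a4 := norm_add_le z (w - z)
      rw [add_sub_cancel] at a3 a4
      linarith
    refine Complex.norm_deriv_le_of_forall_mem_sphere_norm_le (by positivity) ?_
      fun w hw => h2 w (hsub (Metric.sphere_subset_closedBall hw))
    refine (h1.mono ?_).diffContOnCl
    exact (closure_mono Metric.ball_subset_closedBall).trans
      (Metric.isClosed_closedBall.closure_eq.le.trans hsub)
  · filter_upwards [hdiff] with ω h1 z hz
    refine (h1.differentiableAt (Metric.isOpen_ball.mem_nhds ?_)).hasDerivAt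
    rw [mem_ball_zero_iff]
    have a1 := mem_ball_iff_norm.1 hz
    have a3 := norm_add_le z₀ (z - z₀)
    rw [add_sub_cancel] at a3
    linarith

/-! ### The incomplete beta function near its upper endpoint -/

/-- The Euler-type integral `∫_0^1 w^e (1 + t w)^(-q) dw`, which carries the dependence of
`betaInc` on its third argument and, unlike `betaInc`, is analytic at `t = 0`. -/
noncomputable def eulerInt (e : ℝ) (q : ℕ) (t : ℝ) : ℝ :=
  ∫ w in Set.Ioo (0 : ℝ) 1, w ^ e * ((1 + t * w) ^ q)⁻¹

/-- Extension of `eulerInt` to a complex argument. -/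
noncomputable def eulerIntC (e : ℝ) (q : ℕ) (z : ℂ) : ℂ :=
  ∫ w in Set.Ioo (0 : ℝ) 1, ((w ^ e : ℝ) : ℂ) * ((1 + z * w) ^ q)⁻¹

theorem eulerIntC_ofReal (e : ℝ) (q : ℕ) (t : ℝ) : eulerIntC e q t = (eulerInt e q t : ℂ) := by
  rw [eulerIntC, eulerInt, ← integral_complex_ofReal]
  congr 1
  ext w
  push_cast
  rfl

theorem measurable_eulerIntC (e : ℝ) (q : ℕ) : Measurable (eulerIntC e q) :=
  (by fun_prop : Measurable fun x : ℂ × ℝ =>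
    ((x.2 ^ e : ℝ) : ℂ) * ((1 + x.1 * x.2) ^ q)⁻¹).stronglyMeasurable.integral_prod_right'.measurable

theorem integrableOn_rpow_Ioo {e : ℝ} (he : -1 < e) :
    IntegrableOn (fun w : ℝ => w ^ e) (Set.Ioo 0 1) := by
  have h := (intervalIntegral.intervalIntegrable_rpow' (a := 0) (b := 1) he).1
  exact h.mono_set Set.Ioo_subset_Ioc_self

theorem half_le_norm_one_add {z : ℂ} (hz : ‖z‖ ≤ 1 / 2) {w : ℝ} (hw : w ∈ Set.Icc (0 : ℝ) 1) :
    1 / 2 ≤ ‖1 + z * w‖ := by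
  have h1 : ‖z * w‖ ≤ 1 / 2 := by
    rw [norm_mul, Complex.norm_real, Real.norm_of_nonneg hw.1]
    nlinarith [norm_nonneg z, hw.1, hw.2]
  have h2 := norm_sub_le (1 + z * w) (z * w)
  rw [add_sub_cancel_right, norm_one] at h2
  linarith

theorem norm_inv_pow_le {z : ℂ} (q : ℕ) (hz : 1 / 2 ≤ ‖z‖) : ‖(z ^ q)⁻¹‖ ≤ 2 ^ q := by
  rw [norm_inv, norm_pow, ← inv_pow]
  refine pow_le_pow_left₀ (by positivity) ?_ _
  rw [inv_le_comm₀ (by linarith) (by norm_num)]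
  linarith

theorem norm_eulerIntC_integrand_le (e : ℝ) (q : ℕ) {z : ℂ} (hz : z ∈ Metric.ball (0 : ℂ) (1 / 2))
    {w : ℝ} (hw : w ∈ Set.Ioo (0 : ℝ) 1) :
    ‖((w ^ e : ℝ) : ℂ) * ((1 + z * w) ^ q)⁻¹‖ ≤ w ^ e * 2 ^ q := by
  have hz' : ‖z‖ ≤ 1 / 2 := by simpa using (mem_ball_zero_iff.1 hz).le
  rw [norm_mul, Complex.norm_real, Real.norm_of_nonneg (Real.rpow_nonneg hw.1.le _)]
  exact mul_le_mul_of_nonneg_left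
    (norm_inv_pow_le q (half_le_norm_one_add hz' ⟨hw.1.le, hw.2.le⟩)) (Real.rpow_nonneg hw.1.le _)

theorem differentiableOn_eulerIntC {e : ℝ} (he : -1 < e) (q : ℕ) :
    DifferentiableOn ℂ (eulerIntC e q) (Metric.ball 0 (1 / 2)) := by
  refine differentiableOn_integral_of_dominated (bound := fun w => w ^ e * 2 ^ q) ?_ ?_ ?_
    ((integrableOn_rpow_Ioo he).mul_const _)
  · intro z _
    exact (by fun_prop : Measurable fun w : ℝ =>
      ((w ^ e : ℝ) : ℂ) * ((1 + z * w) ^ q)⁻¹).aestronglyMeasurable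
  · filter_upwards [ae_restrict_mem measurableSet_Ioo] with w hw
    refine DifferentiableOn.const_mul (DifferentiableOn.inv (by fun_prop) fun z hz => ?_) _
    have hz' : ‖z‖ ≤ 1 / 2 := by simpa using (mem_ball_zero_iff.1 hz).le
    refine pow_ne_zero _ (norm_pos_iff.1 ?_)
    linarith [half_le_norm_one_add hz' ⟨hw.1.le, hw.2.le⟩]
  · filter_upwards [ae_restrict_mem measurableSet_Ioo] with w hw z hz
    exact norm_eulerIntC_integrand_le e q hz hw

theorem exists_norm_eulerIntC_le {e : ℝ} (he : -1 < e) (q : ℕ) :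
    ∃ K : ℝ, ∀ z ∈ Metric.ball (0 : ℂ) (1 / 2), ‖eulerIntC e q z‖ ≤ K := by
  refine ⟨∫ w in Set.Ioo (0 : ℝ) 1, w ^ e * 2 ^ q, fun z hz => ?_⟩
  refine norm_integral_le_of_norm_le ((integrableOn_rpow_Ioo he).mul_const _) ?_
  filter_upwards [ae_restrict_mem measurableSet_Ioo] with w hw
  exact norm_eulerIntC_integrand_le e q hz hw

theorem eulerInt_zero_pos {e : ℝ} (he : -1 < e) (q : ℕ) : 0 < eulerInt e q 0 := by
  have h : eulerInt e q 0 = ∫ w in (0 : ℝ)..1, w ^ e := by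
    rw [intervalIntegral.integral_of_le zero_le_one, integral_Ioc_eq_integral_Ioo, eulerInt]
    simp
  rw [h, integral_rpow (Or.inl he), Real.one_rpow, Real.zero_rpow (by linarith), sub_zero]
  exact one_div_pos.2 (by linarith)

/-- The substitution `u = 1 / (1 + t w)`: if `a + b` is the natural number `q`, then
`B'(a, b, 1 / (1 + t)) = t^b ∫_0^1 w^(b-1) (1 + t w)^(-q) dw`. -/
theorem betaInc_eq {a b t : ℝ} {q : ℕ} (hab : a + b = q) (ht : 0 < t) :
    betaInc a b (1 / (1 + t)) = t ^ b * eulerInt (b - 1) q t := by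
  have hpos : ∀ w ∈ Set.Ioo (0 : ℝ) 1, 0 < 1 + t * w := fun w hw => by
    have := mul_pos ht hw.1
    linarith
  have himg : (fun w : ℝ => 1 / (1 + t * w)) '' Set.Ioo 0 1 = Set.Ioo (1 / (1 + t)) 1 := by
    ext u
    constructor
    · rintro ⟨w, hw, rfl⟩
      have h0 := hpos w hw
      constructor
      · exact one_div_lt_one_div_of_lt h0 (by nlinarith [hw.2])
      · rw [div_lt_one h0]
        nlinarith [hw.1]
    · rintro ⟨h1, h2⟩
      have hu : 0 < u := lt_trans (by positivity) h1
      rw [div_lt_iff₀ (by linarith)] at h1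
      refine ⟨(1 - u) / (t * u), ⟨?_, ?_⟩, ?_⟩
      · exact div_pos (by linarith) (by positivity)
      · rw [div_lt_one (by positivity)]
        linarith
      · field_simp
        ring
  have hinj : Set.InjOn (fun w : ℝ => 1 / (1 + t * w)) (Set.Ioo 0 1) := by
    intro x hx y hy hxy
    have h1 : 1 + t * x = 1 + t * y := by simpa using hxy
    exact mul_left_cancel₀ ht.ne' (add_left_cancel h1)
  have hder : ∀ w ∈ Set.Ioo (0 : ℝ) 1, HasDerivWithinAt (fun w : ℝ => 1 / (1 + t * w))
      (-t / (1 + t * w) ^ 2) (Set.Ioo 0 1) w := by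
    intro w hw
    have h1 : HasDerivAt (fun w : ℝ => 1 + t * w) t w := by
      simpa using ((hasDerivAt_id w).const_mul t).const_add 1
    simp only [one_div]
    exact (h1.fun_inv (hpos w hw).ne').hasDerivWithinAt
  have hle : 1 / (1 + t) ≤ 1 := by
    rw [div_le_one (by linarith)]
    linarith
  rw [betaInc, intervalIntegral.integral_of_le hle, integral_Ioc_eq_integral_Ioo, ← himg,
    integral_image_eq_integral_abs_deriv_smul measurableSet_Ioo hder hinj, eulerInt,
    ← integral_const_mul]
  refine setIntegral_congr_fun measurableSet_Ioo fun w hw => ?_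
  have h0 := hpos w hw
  have h1 : 1 - 1 / (1 + t * w) = t * w / (1 + t * w) := by
    field_simp
    ring
  have h2 : |-t / (1 + t * w) ^ 2| = t / (1 + t * w) ^ 2 := by
    rw [abs_div, abs_neg, abs_of_pos ht, abs_of_pos (by positivity)]
  have h3 : (1 + t * w) ^ q = (1 + t * w) ^ (a - 1) * (1 + t * w) ^ (b - 1) * (1 + t * w) ^ 2 := by
    rw [← Real.rpow_natCast, ← Real.rpow_natCast, ← Real.rpow_add h0, ← Real.rpow_add h0, ← hab]
    congr 1
    push_cast
    ring
  have h4 : t ^ b = t * t ^ (b - 1) := by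
    rw [Real.rpow_sub_one ht.ne']
    field_simp
  simp only [smul_eq_mul, h1, h2]
  rw [h3, h4, Real.div_rpow zero_le_one h0.le, Real.one_rpow,
    Real.div_rpow (mul_pos ht hw.1).le h0.le, Real.mul_rpow ht.le hw.1.le]
  have := Real.rpow_pos_of_pos h0 (a - 1)
  have := Real.rpow_pos_of_pos h0 (b - 1)
  field_simp

end HetNet

namespace HetNet

/-! ### Holomorphic families of subexponential growth -/

/-- A family of functions of `v ≥ 0` that depends holomorphically on a parameter `z` near `0` and
grows more slowly than every exponential `exp (δ v)`, uniformly for `z` near `0` (how near may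
depend on `δ`). -/
structure IsTame (F : ℂ → ℝ → ℂ) : Prop where
  meas : Measurable fun x : ℂ × ℝ => F x.1 x.2
  diff : ∃ ε > 0, ∀ v, DifferentiableOn ℂ (fun z => F z v) (Metric.ball 0 ε)
  bound : ∀ δ > 0, ∃ ε > 0, ∃ K : ℝ, ∀ z ∈ Metric.ball (0 : ℂ) ε, ∀ v, 0 ≤ v →
    ‖F z v‖ ≤ K * Real.exp (δ * v)

namespace IsTame

theorem const (c : ℂ) : IsTame fun _ _ => c where
  meas := measurable_const
  diff := ⟨1, one_pos, fun _ => differentiableOn_const c⟩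
  bound δ hδ := ⟨1, one_pos, ‖c‖, fun _ _ v hv =>
    le_mul_of_one_le_right (norm_nonneg c) (Real.one_le_exp (by positivity))⟩

theorem mul {F G : ℂ → ℝ → ℂ} (hF : IsTame F) (hG : IsTame G) :
    IsTame fun z v => F z v * G z v where
  meas := hF.meas.mul hG.meas
  diff := by
    obtain ⟨ε₁, h₁, hd₁⟩ := hF.diff
    obtain ⟨ε₂, h₂, hd₂⟩ := hG.diff
    exact ⟨min ε₁ ε₂, lt_min h₁ h₂, fun v =>
      ((hd₁ v).mono (Metric.ball_subset_ball (min_le_left _ _))).mul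
        ((hd₂ v).mono (Metric.ball_subset_ball (min_le_right _ _)))⟩
  bound δ hδ := by
    obtain ⟨ε₁, h₁, K₁, hK₁⟩ := hF.bound (δ / 2) (by positivity)
    obtain ⟨ε₂, h₂, K₂, hK₂⟩ := hG.bound (δ / 2) (by positivity)
    refine ⟨min ε₁ ε₂, lt_min h₁ h₂, K₁ * K₂, fun z hz v hv => ?_⟩
    have b₁ := hK₁ z (Metric.ball_subset_ball (min_le_left _ _) hz) v hv
    have b₂ := hK₂ z (Metric.ball_subset_ball (min_le_right _ _) hz) v hv
    calc ‖F z v * G z v‖ = ‖F z v‖ * ‖G z v‖ := norm_mul _ _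
      _ ≤ (K₁ * Real.exp (δ / 2 * v)) * (K₂ * Real.exp (δ / 2 * v)) :=
          mul_le_mul b₁ b₂ (norm_nonneg _) ((norm_nonneg _).trans b₁)
      _ = K₁ * K₂ * Real.exp (δ * v) := by
          rw [mul_mul_mul_comm, ← Real.exp_add]
          ring_nf

theorem add {F G : ℂ → ℝ → ℂ} (hF : IsTame F) (hG : IsTame G) :
    IsTame fun z v => F z v + G z v where
  meas := hF.meas.add hG.meas
  diff := by
    obtain ⟨ε₁, h₁, hd₁⟩ := hF.diff
    obtain ⟨ε₂, h₂, hd₂⟩ := hG.diff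
    exact ⟨min ε₁ ε₂, lt_min h₁ h₂, fun v =>
      ((hd₁ v).mono (Metric.ball_subset_ball (min_le_left _ _))).add
        ((hd₂ v).mono (Metric.ball_subset_ball (min_le_right _ _)))⟩
  bound δ hδ := by
    obtain ⟨ε₁, h₁, K₁, hK₁⟩ := hF.bound δ hδ
    obtain ⟨ε₂, h₂, K₂, hK₂⟩ := hG.bound δ hδ
    refine ⟨min ε₁ ε₂, lt_min h₁ h₂, K₁ + K₂, fun z hz v hv => ?_⟩
    have b₁ := hK₁ z (Metric.ball_subset_ball (min_le_left _ _) hz) v hv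
    have b₂ := hK₂ z (Metric.ball_subset_ball (min_le_right _ _) hz) v hv
    rw [add_mul]
    exact (norm_add_le _ _).trans (add_le_add b₁ b₂)

theorem pow {F : ℂ → ℝ → ℂ} (hF : IsTame F) (n : ℕ) : IsTame fun z v => F z v ^ n := by
  induction n with
  | zero => simpa using const 1
  | succ n ih => simpa only [pow_succ] using ih.mul hF

theorem sum {ι : Type*} (s : Finset ι) {F : ι → ℂ → ℝ → ℂ} (hF : ∀ i, IsTame (F i)) :
    IsTame fun z v => ∑ i ∈ s, F i z v := by
  classical
  induction s using Finset.induction_on with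
  | empty => simpa using const 0
  | insert i s hi ih => simpa only [Finset.sum_insert hi] using (hF i).add ih

theorem prod {ι : Type*} (s : Finset ι) {F : ι → ℂ → ℝ → ℂ} (hF : ∀ i, IsTame (F i)) :
    IsTame fun z v => ∏ i ∈ s, F i z v := by
  classical
  induction s using Finset.induction_on with
  | empty => simpa using const 1
  | insert i s hi ih => simpa only [Finset.prod_insert hi] using (hF i).mul ih

theorem ofReal_mul {h : ℂ → ℂ} {ε K : ℝ} (hm : Measurable h) (hε : 0 < ε)
    (hd : DifferentiableOn ℂ h (Metric.ball 0 ε)) (hK : ∀ z ∈ Metric.ball (0 : ℂ) ε, ‖h z‖ ≤ K) :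
    IsTame fun z v => (v : ℂ) * h z where
  meas := by fun_prop
  diff := ⟨ε, hε, fun v => hd.const_mul _⟩
  bound δ hδ := by
    refine ⟨ε, hε, δ⁻¹ * K, fun z hz v hv => ?_⟩
    have h1 : δ * v ≤ Real.exp (δ * v) := by linarith [Real.add_one_le_exp (δ * v)]
    have hK0 : 0 ≤ K := (norm_nonneg _).trans (hK z hz)
    calc ‖(v : ℂ) * h z‖ = v * ‖h z‖ := by rw [norm_mul, Complex.norm_real, Real.norm_of_nonneg hv]
      _ ≤ v * K := mul_le_mul_of_nonneg_left (hK z hz) hv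
      _ = δ⁻¹ * K * (δ * v) := by field_simp
      _ ≤ δ⁻¹ * K * Real.exp (δ * v) := mul_le_mul_of_nonneg_left h1 (by positivity)

/-- The factor `z` makes the rate of the exponential as small as desired near `z = 0`. -/
theorem exp_ofReal_mul {h : ℂ → ℂ} {ε K : ℝ} (hm : Measurable h) (hε : 0 < ε)
    (hd : DifferentiableOn ℂ h (Metric.ball 0 ε)) (hK : ∀ z ∈ Metric.ball (0 : ℂ) ε, ‖h z‖ ≤ K) :
    IsTame fun z v => Complex.exp ((v : ℂ) * (z * h z)) where
  meas := by fun_prop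
  diff := ⟨ε, hε, fun v => ((differentiableOn_id.mul hd).const_mul _).cexp⟩
  bound δ hδ := by
    have hK0 : 0 ≤ K := (norm_nonneg _).trans (hK 0 (Metric.mem_ball_self hε))
    refine ⟨min ε (δ / (K + 1)), lt_min hε (by positivity), 1, fun z hz v hv => ?_⟩
    have hz1 := hK z (Metric.ball_subset_ball (min_le_left _ _) hz)
    have hz2 : ‖z‖ < δ / (K + 1) :=
      mem_ball_zero_iff.1 (Metric.ball_subset_ball (min_le_right _ _) hz)
    rw [lt_div_iff₀ (by positivity)] at hz2
    rw [one_mul, Complex.norm_exp]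
    refine Real.exp_le_exp.2 ((Complex.re_le_norm _).trans ?_)
    rw [norm_mul, norm_mul, Complex.norm_real, Real.norm_of_nonneg hv, mul_comm]
    refine mul_le_mul_of_nonneg_right ?_ hv
    nlinarith [norm_nonneg z, norm_nonneg (h z)]

end IsTame

/-! ### Laplace transforms of the interference -/

/-- The function `laplaceD` without its factor `t ^ m`, in the variables `t = s r^(-alpha)` and
`v = r ^ 2`; it is analytic at `t = 0`. -/
noncomputable def laplaceCore (lam alpha : ℝ) (m : ℕ) (t v : ℝ) : ℝ :=
  Real.exp (v * (t * (-(2 * Real.pi * lam / alpha) * eulerInt (1 - 2 / alpha - 1) 1 t))) *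
    ∑ p ∈ weightedTuples m,
      ((m.factorial : ℝ) / ∏ a : Fin m, ((p a).factorial : ℝ)) *
        ∏ a : Fin m, (v * (2 * Real.pi / alpha * lam *
          eulerInt (((a : ℕ) : ℝ) + 1 - 2 / alpha - 1) (a + 2) t)) ^ p a

/-- Extension of `laplaceCore` to a complex argument `t`. -/
noncomputable def laplaceCoreC (lam alpha : ℝ) (m : ℕ) (z : ℂ) (v : ℝ) : ℂ :=
  Complex.exp (v * (z * (((-(2 * Real.pi * lam / alpha) : ℝ) : ℂ) *
      eulerIntC (1 - 2 / alpha - 1) 1 z))) *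
    ∑ p ∈ weightedTuples m,
      (((m.factorial : ℝ) / ∏ a : Fin m, ((p a).factorial : ℝ) : ℝ) : ℂ) *
        ∏ a : Fin m, (v * (((2 * Real.pi / alpha * lam : ℝ) : ℂ) *
          eulerIntC (((a : ℕ) : ℝ) + 1 - 2 / alpha - 1) (a + 2) z)) ^ p a

theorem laplaceCoreC_ofReal (lam alpha : ℝ) (m : ℕ) (t v : ℝ) :
    laplaceCoreC lam alpha m t v = (laplaceCore lam alpha m t v : ℂ) := by
  simp only [laplaceCoreC, laplaceCore, eulerIntC_ofReal]
  push_cast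
  rfl

theorem two_div_lt_one {alpha : ℝ} (ha : 2 < alpha) : 2 / alpha < 1 := by
  rw [div_lt_one (by linarith)]
  exact ha

theorem isTame_laplaceCoreC (lam : ℝ) {alpha : ℝ} (ha : 2 < alpha) (m : ℕ) :
    IsTame (laplaceCoreC lam alpha m) := by
  have h2 := two_div_lt_one ha
  have key : ∀ (c e : ℝ) (q : ℕ), -1 < e →
      DifferentiableOn ℂ (fun z => (c : ℂ) * eulerIntC e q z) (Metric.ball 0 (1 / 2)) ∧
      ∃ K : ℝ, ∀ z ∈ Metric.ball (0 : ℂ) (1 / 2), ‖(c : ℂ) * eulerIntC e q z‖ ≤ K := by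
    intro c e q he
    obtain ⟨K, hK⟩ := exists_norm_eulerIntC_le he q
    refine ⟨(differentiableOn_eulerIntC he q).const_mul _, ‖(c : ℂ)‖ * K, fun z hz => ?_⟩
    rw [norm_mul]
    exact mul_le_mul_of_nonneg_left (hK z hz) (norm_nonneg _)
  refine IsTame.mul ?_ (IsTame.sum _ fun p => (IsTame.const _).mul
    (IsTame.prod _ fun a => IsTame.pow ?_ _))
  · obtain ⟨hd, K, hK⟩ := key (-(2 * Real.pi * lam / alpha)) (1 - 2 / alpha - 1) 1 (by linarith)
    exact IsTame.exp_ofReal_mul ((measurable_eulerIntC _ _).const_mul _) (by norm_num) hd hK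
  · obtain ⟨hd, K, hK⟩ := key (2 * Real.pi / alpha * lam)
      (((a : ℕ) : ℝ) + 1 - 2 / alpha - 1) (a + 2)
      (by linarith [(a : ℕ).cast_nonneg (α := ℝ)])
    exact IsTame.ofReal_mul ((measurable_eulerIntC _ _).const_mul _) (by norm_num) hd hK

theorem weightedTuples_nonempty (m : ℕ) : (weightedTuples m).Nonempty := by
  refine ⟨fun a => if (a : ℕ) = 0 then m else 0, mem_weightedTuples.2 ?_⟩
  cases m with
  | zero => simp
  | succ k => simp

theorem laplaceCore_zero_pos {lam alpha : ℝ} (hlam : 0 < lam) (ha : 2 < alpha) (m : ℕ) {v : ℝ}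
    (hv : 0 < v) : 0 < laplaceCore lam alpha m 0 v := by
  have h2 := two_div_lt_one ha
  refine mul_pos (Real.exp_pos _) (Finset.sum_pos (fun p _ => mul_pos ?_ ?_)
    (weightedTuples_nonempty m))
  · exact div_pos (by positivity) (Finset.prod_pos fun a _ => by positivity)
  · refine Finset.prod_pos fun a _ => pow_pos (mul_pos hv (mul_pos ?_ ?_)) _
    · have : 0 < alpha := by linarith
      have := Real.pi_pos
      positivity
    · exact eulerInt_zero_pos (by linarith [(a : ℕ).cast_nonneg (α := ℝ)]) _

theorem laplaceD_eq {lam alpha s r : ℝ} (ha : 2 < alpha) (m : ℕ) (hs : 0 < s) (hr : 0 < r) :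
    laplaceD lam alpha m s r =
      (s * r ^ (-alpha)) ^ m * laplaceCore lam alpha m (s * r ^ (-alpha)) (r ^ 2) := by
  have ha0 : 0 < alpha := by linarith
  have ht : 0 < s * r ^ (-alpha) := mul_pos hs (Real.rpow_pos_of_pos hr _)
  have hst : s ^ (2 / alpha) = (s * r ^ (-alpha)) ^ (2 / alpha) * r ^ 2 := by
    rw [Real.mul_rpow hs.le (Real.rpow_nonneg hr.le _), ← Real.rpow_mul hr.le, mul_assoc,
      ← Real.rpow_natCast, ← Real.rpow_add hr]
    have : -alpha * (2 / alpha) + ((2 : ℕ) : ℝ) = 0 := by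
      field_simp
      norm_num
    rw [this, Real.rpow_zero, mul_one]
  set t := s * r ^ (-alpha) with ht_def
  have h0 : s ^ (2 / alpha) * betaInc (2 / alpha) (1 - 2 / alpha) (1 / (1 + t)) =
      r ^ 2 * (t * eulerInt (1 - 2 / alpha - 1) 1 t) := by
    rw [betaInc_eq (q := 1) (by push_cast; ring) ht, hst]
    have : t ^ (2 / alpha) * t ^ (1 - 2 / alpha) = t := by
      rw [← Real.rpow_add ht]
      simp
    calc _ = r ^ 2 * ((t ^ (2 / alpha) * t ^ (1 - 2 / alpha)) *
          eulerInt (1 - 2 / alpha - 1) 1 t) := by ring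
      _ = _ := by rw [this]
  have h1 : ∀ a : ℕ, s ^ (2 / alpha) *
      betaInc (1 + 2 / alpha) ((a : ℝ) + 1 - 2 / alpha) (1 / (1 + t)) =
      t ^ (a + 1) * (r ^ 2 * eulerInt ((a : ℝ) + 1 - 2 / alpha - 1) (a + 2) t) := by
    intro a
    rw [betaInc_eq (q := a + 2) (by push_cast; ring) ht, hst]
    have : t ^ (2 / alpha) * t ^ ((a : ℝ) + 1 - 2 / alpha) = t ^ (a + 1) := by
      rw [← Real.rpow_add ht, ← Real.rpow_natCast]
      congr 1
      push_cast
      ring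
    calc _ = (t ^ (2 / alpha) * t ^ ((a : ℝ) + 1 - 2 / alpha)) * (r ^ 2 *
          eulerInt ((a : ℝ) + 1 - 2 / alpha - 1) (a + 2) t) := by ring
      _ = _ := by rw [this]
  rw [laplaceD, laplace, laplaceCore, mul_left_comm]
  congr 1
  · congr 1
    rw [mul_assoc, h0]
    ring
  · rw [Finset.mul_sum]
    refine Finset.sum_congr rfl fun p hp => ?_
    rw [mem_weightedTuples] at hp
    rw [mul_left_comm]
    congr 1
    calc _ = ∏ a : Fin m, (t ^ ((a : ℕ) + 1)) ^ p a * (r ^ 2 * (2 * Real.pi / alpha * lam *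
          eulerInt (((a : ℕ) : ℝ) + 1 - 2 / alpha - 1) (a + 2) t)) ^ p a := by
          refine Finset.prod_congr rfl fun a _ => ?_
          rw [← mul_pow, mul_assoc (2 * Real.pi / alpha * lam), h1]
          congr 1
          ring
      _ = _ := by
          rw [Finset.prod_mul_distrib]
          simp only [← pow_mul]
          rw [Finset.prod_pow_eq_pow_sum, hp]

end HetNet

namespace HetNet

/-! ### Averages over the positions of the base stations -/

/-- The positions `ω` over which a coverage probability is averaged, with law proportional to
`w ω dμ`. At SIR threshold `β` the Laplace transform of tier `j` is taken at `t = β κ_j ω`, with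
squared exclusion radius `v_j ω`. The constant `K` bounds `κ₁` and `κ₂`, and `δ` is an exponential
rate in the squared radii at which `w` still has an integrable tail. -/
structure Geometry (Ω : Type*) [MeasurableSpace Ω] where
  μ : Measure Ω
  κ₁ : Ω → ℝ
  κ₂ : Ω → ℝ
  v₁ : Ω → ℝ
  v₂ : Ω → ℝ
  w : Ω → ℝ
  K : ℝ
  δ : ℝ
  measurable_κ₁ : Measurable κ₁
  measurable_κ₂ : Measurable κ₂
  measurable_v₁ : Measurable v₁
  measurable_v₂ : Measurable v₂
  measurable_w : Measurable w
  δ_pos : 0 < δ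
  μ_ne_zero : μ ≠ 0
  ae_pos : ∀ᵐ ω ∂μ, 0 < κ₁ ω ∧ 0 < κ₂ ω ∧ 0 < v₁ ω ∧ 0 < v₂ ω ∧ 0 < w ω
  ae_le : ∀ᵐ ω ∂μ, κ₁ ω ≤ K ∧ κ₂ ω ≤ K
  integrable_w : Integrable (fun ω => w ω * Real.exp (δ * (v₁ ω + v₂ ω))) μ

namespace Geometry

variable {Ω : Type*} [MeasurableSpace Ω] (g : Geometry Ω)

/-- Near `β = 0` the weight `w` absorbs the growth of two tame families in the squared distances,
so that their mean is holomorphic in `β`. -/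
theorem integral_holomorphic {F G : ℂ → ℝ → ℂ} (hF : IsTame F) (hG : IsTame G) (a b p : ℕ) :
    ∃ ε > 0,
      (∀ z ∈ Metric.ball (0 : ℂ) ε, Integrable (fun ω => F (z * g.κ₁ ω) (g.v₁ ω) *
        G (z * g.κ₂ ω) (g.v₂ ω) * ((1 + z * g.κ₁ ω) ^ p)⁻¹ *
        ((g.κ₁ ω ^ a * g.κ₂ ω ^ b * g.w ω : ℝ) : ℂ)) g.μ) ∧
      DifferentiableOn ℂ (fun z => ∫ ω, F (z * g.κ₁ ω) (g.v₁ ω) *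
        G (z * g.κ₂ ω) (g.v₂ ω) * ((1 + z * g.κ₁ ω) ^ p)⁻¹ *
        ((g.κ₁ ω ^ a * g.κ₂ ω ^ b * g.w ω : ℝ) : ℂ) ∂g.μ) (Metric.ball 0 ε) := by
  obtain ⟨ε₁, hε₁, hd₁⟩ := hF.diff
  obtain ⟨ε₂, hε₂, hd₂⟩ := hG.diff
  obtain ⟨ε₃, hε₃, K₁, hK₁⟩ := hF.bound g.δ g.δ_pos
  obtain ⟨ε₄, hε₄, K₂, hK₂⟩ := hG.bound g.δ g.δ_pos
  obtain ⟨η, hη, hη₁, hη₂, hη₃, hη₄, hη₅⟩ :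
      ∃ η > 0, η ≤ ε₁ ∧ η ≤ ε₂ ∧ η ≤ ε₃ ∧ η ≤ ε₄ ∧ η ≤ (1 / 2 : ℝ) :=
    ⟨min ε₁ (min ε₂ (min ε₃ (min ε₄ (1 / 2)))), by positivity, by simp, by simp, by simp, by simp,
      by simp⟩
  have hmem : ∀ {z : ℂ} {k : ℝ}, z ∈ Metric.ball (0 : ℂ) (η / (|g.K| + 1)) → 0 < k → k ≤ g.K →
      z * k ∈ Metric.ball (0 : ℂ) η := by
    intro z k hz hk hkK
    rw [mem_ball_zero_iff] at hz ⊢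
    rw [lt_div_iff₀ (by positivity)] at hz
    rw [norm_mul, Complex.norm_real, Real.norm_of_nonneg hk.le]
    refine lt_of_le_of_lt (mul_le_mul_of_nonneg_left ?_ (norm_nonneg z)) hz
    linarith [le_abs_self g.K]
  have hmeas : ∀ z : ℂ, AEStronglyMeasurable (fun ω => F (z * g.κ₁ ω) (g.v₁ ω) *
        G (z * g.κ₂ ω) (g.v₂ ω) * ((1 + z * g.κ₁ ω) ^ p)⁻¹ *
        ((g.κ₁ ω ^ a * g.κ₂ ω ^ b * g.w ω : ℝ) : ℂ)) g.μ := by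
    intro z
    have m1 := g.measurable_κ₁
    have m2 := g.measurable_κ₂
    have m3 := g.measurable_v₁
    have m4 := g.measurable_v₂
    have m5 := g.measurable_w
    have m6 : Measurable fun ω => F (z * g.κ₁ ω) (g.v₁ ω) :=
      hF.meas.comp (g := fun x : ℂ × ℝ => F x.1 x.2) (f := fun ω => (z * g.κ₁ ω, g.v₁ ω))
        (by fun_prop)
    have m7 : Measurable fun ω => G (z * g.κ₂ ω) (g.v₂ ω) :=
      hG.meas.comp (g := fun x : ℂ × ℝ => G x.1 x.2) (f := fun ω => (z * g.κ₂ ω, g.v₂ ω))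
        (by fun_prop)
    exact (((m6.mul m7).mul (by fun_prop)).mul (by fun_prop)).aestronglyMeasurable
  have hbound : ∀ᵐ ω ∂g.μ, ∀ z ∈ Metric.ball (0 : ℂ) (η / (|g.K| + 1)),
      ‖F (z * g.κ₁ ω) (g.v₁ ω) * G (z * g.κ₂ ω) (g.v₂ ω) * ((1 + z * g.κ₁ ω) ^ p)⁻¹ *
        ((g.κ₁ ω ^ a * g.κ₂ ω ^ b * g.w ω : ℝ) : ℂ)‖ ≤
      (K₁ * K₂ * 2 ^ p * g.K ^ (a + b)) *
        (g.w ω * Real.exp (g.δ * (g.v₁ ω + g.v₂ ω))) := by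
    filter_upwards [g.ae_pos, g.ae_le] with ω ⟨h1, h2, h3, h4, h5⟩ ⟨h6, h7⟩ z hz
    have z1 := hmem hz h1 h6
    have z2 := hmem hz h2 h7
    have b1 := hK₁ _ (Metric.ball_subset_ball hη₃ z1) _ h3.le
    have b2 := hK₂ _ (Metric.ball_subset_ball hη₄ z2) _ h4.le
    have b3 : ‖((1 + z * g.κ₁ ω) ^ p)⁻¹‖ ≤ 2 ^ p := by
      refine norm_inv_pow_le p ?_
      have hz1 : ‖z * g.κ₁ ω‖ ≤ 1 / 2 := (mem_ball_zero_iff.1 z1).le.trans hη₅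
      simpa using half_le_norm_one_add hz1 (w := 1) (by simp)
    have b4 : ‖((g.κ₁ ω ^ a * g.κ₂ ω ^ b * g.w ω : ℝ) : ℂ)‖ ≤ g.K ^ (a + b) * g.w ω := by
      rw [Complex.norm_real, Real.norm_of_nonneg (by positivity), pow_add]
      have := h1.le.trans h6
      gcongr
    rw [norm_mul, norm_mul, norm_mul]
    have c1 := mul_le_mul b1 b2 (norm_nonneg _) ((norm_nonneg _).trans b1)
    have c2 := mul_le_mul c1 b3 (norm_nonneg _) (le_trans (by positivity) c1)
    have c3 := mul_le_mul c2 b4 (norm_nonneg _) (le_trans (by positivity) c2)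
    refine c3.trans (le_of_eq ?_)
    rw [mul_add, Real.exp_add]
    ring
  refine ⟨η / (|g.K| + 1), by positivity, fun z hz => ?_, ?_⟩
  · exact (g.integrable_w.const_mul _).mono' (hmeas z) (hbound.mono fun ω h => h z hz)
  · refine differentiableOn_integral_of_dominated (fun z _ => hmeas z) ?_ hbound
      (g.integrable_w.const_mul _)
    filter_upwards [g.ae_pos, g.ae_le] with ω ⟨h1, h2, h3, h4, h5⟩ ⟨h6, h7⟩
    refine DifferentiableOn.mul_const (DifferentiableOn.mul (DifferentiableOn.mul ?_ ?_) ?_) _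
    · exact ((hd₁ (g.v₁ ω)).mono (Metric.ball_subset_ball hη₁)).comp (by fun_prop)
        fun z hz => hmem hz h1 h6
    · exact ((hd₂ (g.v₂ ω)).mono (Metric.ball_subset_ball hη₂)).comp (by fun_prop)
        fun z hz => hmem hz h2 h7
    · refine DifferentiableOn.inv (by fun_prop) fun z hz => pow_ne_zero _ (norm_pos_iff.1 ?_)
      have hz1 : ‖z * g.κ₁ ω‖ ≤ 1 / 2 := (mem_ball_zero_iff.1 (hmem hz h1 h6)).le.trans hη₅
      have := half_le_norm_one_add hz1 (w := 1) (by simp)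
      rw [Complex.ofReal_one, mul_one] at this
      linarith

/-- The real form of `integral_holomorphic` for the scaled Laplace transforms of both tiers. -/
theorem integral_analytic (H : Params) (i j p : ℕ) :
    (∀ᶠ β : ℝ in 𝓝 0, Integrable (fun ω =>
      laplaceCore H.lam1 H.alpha1 i (β * g.κ₁ ω) (g.v₁ ω) *
        laplaceCore H.lam2 H.alpha2 j (β * g.κ₂ ω) (g.v₂ ω) * ((1 + β * g.κ₁ ω) ^ p)⁻¹ *
        (g.κ₁ ω ^ (i + p) * g.κ₂ ω ^ j * g.w ω)) g.μ) ∧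
    AnalyticAt ℝ (fun β => ∫ ω,
      laplaceCore H.lam1 H.alpha1 i (β * g.κ₁ ω) (g.v₁ ω) *
        laplaceCore H.lam2 H.alpha2 j (β * g.κ₂ ω) (g.v₂ ω) * ((1 + β * g.κ₁ ω) ^ p)⁻¹ *
        (g.κ₁ ω ^ (i + p) * g.κ₂ ω ^ j * g.w ω) ∂g.μ) 0 := by
  obtain ⟨ε, hε, hint, hdiff⟩ := g.integral_holomorphic
    (isTame_laplaceCoreC H.lam1 H.two_lt_alpha1 i) (isTame_laplaceCoreC H.lam2 H.two_lt_alpha2 j)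
    (i + p) j p
  have hreal : ∀ (β : ℝ) (ω : Ω),
      laplaceCoreC H.lam1 H.alpha1 i ((β : ℂ) * g.κ₁ ω) (g.v₁ ω) *
        laplaceCoreC H.lam2 H.alpha2 j ((β : ℂ) * g.κ₂ ω) (g.v₂ ω) *
        ((1 + (β : ℂ) * g.κ₁ ω) ^ p)⁻¹ *
        ((g.κ₁ ω ^ (i + p) * g.κ₂ ω ^ j * g.w ω : ℝ) : ℂ) =
      ((laplaceCore H.lam1 H.alpha1 i (β * g.κ₁ ω) (g.v₁ ω) *
        laplaceCore H.lam2 H.alpha2 j (β * g.κ₂ ω) (g.v₂ ω) * ((1 + β * g.κ₁ ω) ^ p)⁻¹ *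
        (g.κ₁ ω ^ (i + p) * g.κ₂ ω ^ j * g.w ω) : ℝ) : ℂ) := by
    intro β ω
    rw [← Complex.ofReal_mul β, ← Complex.ofReal_mul β, laplaceCoreC_ofReal, laplaceCoreC_ofReal]
    push_cast
    rfl
  refine ⟨?_, ?_⟩
  · filter_upwards [Metric.ball_mem_nhds (0 : ℝ) hε] with β hβ
    have h := hint (β : ℂ) (by simpa using hβ)
    simp only [hreal] at h
    exact h.re
  · have h1 := (hdiff.analyticAt (Metric.ball_mem_nhds _ hε)).restrictScalars (𝕜 := ℝ)
    have h2 : AnalyticAt ℝ (fun β : ℝ => (β : ℂ)) 0 := Complex.ofRealCLM.analyticAt 0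
    have h3 := (Complex.reCLM.analyticAt _).comp
      (h1.comp_of_eq (f := fun β : ℝ => (β : ℂ)) h2 (by simp))
    refine h3.congr (Eventually.of_forall fun β => ?_)
    simp only [Function.comp_apply, hreal, integral_complex_ofReal]
    simp

end Geometry

namespace Params

variable (H : Params)

/-- The `m`-th summand of a coverage probability, given the positions of the base stations and
without its factor `β ^ m`; see `Geometry` for the arguments. -/
noncomputable def coverCore (m : ℕ) (β κ₁ κ₂ v₁ v₂ : ℝ) : ℝ :=
  1 / (m.factorial : ℝ) * ∑ k ∈ Finset.range (m + 1), (m.choose k : ℝ) *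
    (κ₁ ^ k * laplaceCore H.lam1 H.alpha1 k (β * κ₁) v₁) *
    (κ₂ ^ (m - k) * laplaceCore H.lam2 H.alpha2 (m - k) (β * κ₂) v₂)

theorem coverCore_zero_pos (m : ℕ) {κ₁ κ₂ v₁ v₂ : ℝ} (h₁ : 0 < κ₁) (h₂ : 0 < κ₂) (h₃ : 0 < v₁)
    (h₄ : 0 < v₂) : 0 < H.coverCore m 0 κ₁ κ₂ v₁ v₂ := by
  refine mul_pos (by positivity) (Finset.sum_pos (fun k hk => ?_) ⟨0, by simp⟩)
  rw [zero_mul, zero_mul]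
  have hk' : 0 < m.choose k := Nat.choose_pos (Nat.lt_succ_iff.1 (Finset.mem_range.1 hk))
  have e1 := laplaceCore_zero_pos H.lam1_pos H.two_lt_alpha1 k h₃
  have e2 := laplaceCore_zero_pos H.lam2_pos H.two_lt_alpha2 (m - k) h₄
  positivity

end Params

namespace Geometry

variable {Ω : Type*} [MeasurableSpace Ω] (g : Geometry Ω)

/-- The integrand of `coverMean`. -/
noncomputable def coverIntegrand (H : Params) (m p : ℕ) (β : ℝ) (ω : Ω) : ℝ :=
  H.coverCore m β (g.κ₁ ω) (g.κ₂ ω) (g.v₁ ω) (g.v₂ ω) *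
    (g.κ₁ ω / (1 + β * g.κ₁ ω)) ^ p * g.w ω

/-- The mean over the positions of `coverCore`, multiplied by `(t / (1 + t)) ^ p / β ^ p`, where
`t = β κ₁` is the parameter of the nearest macro base station. -/
noncomputable def coverMean (H : Params) (m p : ℕ) (β : ℝ) : ℝ :=
  ∫ ω, g.coverIntegrand H m p β ω ∂g.μ

theorem coverIntegrand_eq_sum (H : Params) (m p : ℕ) (β : ℝ) :
    g.coverIntegrand H m p β = fun ω => ∑ k ∈ Finset.range (m + 1),
      (1 / (m.factorial : ℝ) * (m.choose k : ℝ)) *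
      (laplaceCore H.lam1 H.alpha1 k (β * g.κ₁ ω) (g.v₁ ω) *
        laplaceCore H.lam2 H.alpha2 (m - k) (β * g.κ₂ ω) (g.v₂ ω) * ((1 + β * g.κ₁ ω) ^ p)⁻¹ *
        (g.κ₁ ω ^ (k + p) * g.κ₂ ω ^ (m - k) * g.w ω)) := by
  ext ω
  simp only [coverIntegrand, Params.coverCore, Finset.mul_sum, Finset.sum_mul]
  refine Finset.sum_congr rfl fun k _ => ?_
  rw [div_pow, pow_add]
  ring

theorem eventually_integrable (H : Params) (m p : ℕ) :
    ∀ᶠ β : ℝ in 𝓝 0, Integrable (g.coverIntegrand H m p β) g.μ := by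
  filter_upwards [(Finset.eventually_all (Finset.range (m + 1))).2 fun k _ =>
    (g.integral_analytic H k (m - k) p).1] with β hβ
  rw [coverIntegrand_eq_sum]
  exact integrable_finsetSum _ fun k hk => (hβ k hk).const_mul _

theorem analyticAt_coverMean (H : Params) (m p : ℕ) : AnalyticAt ℝ (g.coverMean H m p) 0 := by
  have h : AnalyticAt ℝ (fun β => ∑ k ∈ Finset.range (m + 1),
      (1 / (m.factorial : ℝ) * (m.choose k : ℝ)) * ∫ ω,
      (laplaceCore H.lam1 H.alpha1 k (β * g.κ₁ ω) (g.v₁ ω) *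
        laplaceCore H.lam2 H.alpha2 (m - k) (β * g.κ₂ ω) (g.v₂ ω) * ((1 + β * g.κ₁ ω) ^ p)⁻¹ *
        (g.κ₁ ω ^ (k + p) * g.κ₂ ω ^ (m - k) * g.w ω)) ∂g.μ) 0 :=
    Finset.analyticAt_fun_sum _ fun k _ =>
      analyticAt_const.mul (g.integral_analytic H k (m - k) p).2
  refine h.congr ?_
  filter_upwards [(Finset.eventually_all (Finset.range (m + 1))).2 fun k _ =>
    (g.integral_analytic H k (m - k) p).1] with β hβ
  rw [coverMean, coverIntegrand_eq_sum, integral_finsetSum _ fun k hk => (hβ k hk).const_mul _]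
  simp only [integral_const_mul]

theorem coverMean_zero_pos (H : Params) (m p : ℕ) : 0 < g.coverMean H m p 0 := by
  have hpos : ∀ᵐ ω ∂g.μ, 0 < g.coverIntegrand H m p 0 ω := by
    filter_upwards [g.ae_pos] with ω ⟨h1, h2, h3, h4, h5⟩
    have := H.coverCore_zero_pos m h1 h2 h3 h4
    rw [coverIntegrand, zero_mul, add_zero, div_one]
    positivity
  rw [coverMean, integral_pos_iff_support_of_nonneg_ae (hpos.mono fun _ h => h.le)
    (g.eventually_integrable H m p).self_of_nhds]
  have hsupp : Function.support (g.coverIntegrand H m p 0) =ᵐ[g.μ] Set.univ := by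
    filter_upwards [hpos] with ω h
    exact propext ⟨fun _ => trivial, fun _ => h.ne'⟩
  rw [measure_congr hsupp, Measure.measure_univ_pos]
  exact g.μ_ne_zero

end Geometry

end HetNet

namespace HetNet

/-! ### Association probabilities -/

theorem isFiniteMeasure_nearestDistLaw {lam : ℝ} (hlam : 0 < lam) :
    IsFiniteMeasure (nearestDistLaw lam) := by
  refine isFiniteMeasure_withDensity_ofReal (Integrable.hasFiniteIntegral (Integrable.restrict ?_))
  refine ((integrable_mul_exp_neg_mul_sq (mul_pos Real.pi_pos hlam)).const_mul
    (2 * Real.pi * lam)).congr (Eventually.of_forall fun r => ?_)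
  simp only [mul_assoc, neg_mul]

theorem nearestDistLaw_pos {lam : ℝ} (hlam : 0 < lam) {x : ℝ} (hx : 0 < x) {u : Set ℝ}
    (hu : u ∈ 𝓝 x) : 0 < nearestDistLaw lam u := by
  rw [pos_iff_ne_zero, nearestDistLaw, Ne, withDensity_apply_eq_zero (by fun_prop)]
  have h1 : 0 < volume (u ∩ Set.Ioi 0) :=
    Measure.measure_pos_of_mem_nhds _ (inter_mem hu (Ioi_mem_nhds hx))
  refine (h1.trans_le (le_trans (measure_mono ?_) (Measure.le_restrict_apply _ _))).ne'
  rintro y ⟨hy, hy0 : 0 < y⟩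
  refine ⟨⟨?_, hy⟩, hy0⟩
  have : 0 < 2 * Real.pi * lam * y * Real.exp (-(Real.pi * lam * y ^ 2)) := by positivity
  simpa using this

namespace Params

variable (H : Params)

theorem P1_pos : 0 < H.P1 := H.P2_pos.trans H.P2_lt_P1

theorem B_pos : 0 < H.B := one_pos.trans H.one_lt_B

theorem alpha1_pos : 0 < H.alpha1 := two_pos.trans H.two_lt_alpha1

theorem alpha2_pos : 0 < H.alpha2 := two_pos.trans H.two_lt_alpha2

theorem distLaw_real_pos {x y : ℝ} (hx : 0 < x) (hy : 0 < y) {s : Set (ℝ × ℝ)}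
    (hs : s ∈ 𝓝 (x, y)) : 0 < H.distLaw.real s := by
  have f1 := isFiniteMeasure_nearestDistLaw H.lam1_pos
  have f2 := isFiniteMeasure_nearestDistLaw H.lam2_pos
  have f3 : IsFiniteMeasure H.distLaw := by
    unfold distLaw
    infer_instance
  obtain ⟨u, hu, v, hv, huv⟩ := mem_nhds_prod_iff.1 hs
  rw [measureReal_def, ENNReal.toReal_pos_iff]
  refine ⟨lt_of_lt_of_le ?_ (measure_mono huv), measure_lt_top _ _⟩
  rw [distLaw, Measure.prod_prod]
  exact ENNReal.mul_pos (nearestDistLaw_pos H.lam1_pos hx hu).ne'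
    (nearestDistLaw_pos H.lam2_pos hy hv).ne'

theorem exists_rpow_neg_eq {a c : ℝ} (ha : 0 < a) (hc : 0 < c) : ∃ x : ℝ, 0 < x ∧ x ^ (-a) = c :=
  ⟨c ^ (-a)⁻¹, Real.rpow_pos_of_pos hc _, Real.rpow_inv_rpow hc.le (by linarith)⟩

theorem A1_pos : 0 < H.A1 := by
  have hP := H.P1_pos
  have hB := H.B_pos
  have hP2 := H.P2_pos
  obtain ⟨x, hx, hxe⟩ := exists_rpow_neg_eq H.alpha1_pos
    (show 0 < H.B * H.P2 / H.P1 + 1 by positivity)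
  refine H.distLaw_real_pos hx one_pos ?_
  have c1 : ContinuousAt (fun z : ℝ × ℝ => H.P1 * z.1 ^ (-H.alpha1)) (x, 1) :=
    continuousAt_const.mul (continuousAt_fst.rpow_const (Or.inl hx.ne'))
  have c2 : ContinuousAt (fun z : ℝ × ℝ => H.B * H.P2 * z.2 ^ (-H.alpha2)) (x, 1) :=
    continuousAt_const.mul (continuousAt_snd.rpow_const (Or.inl one_ne_zero))
  filter_upwards [c2.eventually_lt c1 (by
    simp only [Real.one_rpow, mul_one, hxe]
    rw [mul_add, mul_div_cancel₀ _ hP.ne']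
    linarith)] with z hz using hz.le

theorem A2O_pos : 0 < H.A2O := by
  have hP := H.P1_pos
  have hP2 := H.P2_pos
  have hB := H.one_lt_B
  obtain ⟨y, hy, hye⟩ := exists_rpow_neg_eq H.alpha2_pos
    (show 0 < 2 * H.P1 / (H.P2 * (1 + H.B)) by positivity)
  refine H.distLaw_real_pos one_pos hy ?_
  have c1 : ContinuousAt (fun z : ℝ × ℝ => H.P1 * z.1 ^ (-H.alpha1)) (1, y) :=
    continuousAt_const.mul (continuousAt_fst.rpow_const (Or.inl one_ne_zero))
  have c2 : ContinuousAt (fun z : ℝ × ℝ => H.P2 * z.2 ^ (-H.alpha2)) (1, y) :=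
    continuousAt_const.mul (continuousAt_snd.rpow_const (Or.inl hy.ne'))
  have c3 : ContinuousAt (fun z : ℝ × ℝ => H.B * H.P2 * z.2 ^ (-H.alpha2)) (1, y) :=
    continuousAt_const.mul (continuousAt_snd.rpow_const (Or.inl hy.ne'))
  filter_upwards [c2.eventually_lt c1 (by
      simp only [Real.one_rpow, mul_one, hye]
      rw [mul_div_assoc', div_lt_iff₀ (by positivity)]
      nlinarith [mul_pos hP hP2]),
    c1.eventually_lt c3 (by
      simp only [Real.one_rpow, mul_one, hye]
      rw [mul_div_assoc', lt_div_iff₀ (by positivity)]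
      nlinarith [mul_pos hP hP2])] with z h1 h2 using ⟨h1.le, h2⟩

theorem A2_pos : 0 < H.A2 := add_pos_of_pos_of_nonneg H.A2O_pos measureReal_nonneg

/-! ### The number of active offloaded users -/

theorem meanActive_pos : 0 < H.meanActive :=
  div_pos (mul_pos H.lam2_pos H.A2O_pos) (mul_pos H.A2_pos H.lam1_pos)

theorem pmfActive_pos (n : ℕ) : 0 < H.pmfActive n := by
  have h1 : 0 < Real.Gamma (n + 3.5) := Real.Gamma_pos_of_pos (by positivity)
  have h2 : 0 < Real.Gamma 3.5 := Real.Gamma_pos_of_pos (by norm_num)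
  have h3 := H.meanActive_pos
  unfold pmfActive
  positivity

theorem Gamma_add_nat_eq {r : ℝ} (hr : 0 < r) (n : ℕ) :
    Real.Gamma (n + r) = Real.Gamma r * (n.factorial * Ring.choose (r + n - 1) n) := by
  have h1 : ((n.factorial : ℝ)) * Ring.choose (r + n - 1) n = (ascPochhammer ℝ n).eval r := by
    have h2 := Ring.factorial_nsmul_multichoose_eq_ascPochhammer r n
    rw [Polynomial.ascPochhammer_smeval_eq_eval, nsmul_eq_mul] at h2
    rw [← h2, Ring.choose]
    congr 2
    ring
  rw [h1]
  clear h1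
  induction n with
  | zero => simp
  | succ n ih =>
    rw [ascPochhammer_succ_eval, Nat.cast_add_one, add_right_comm,
      Real.Gamma_add_one (by positivity), ih]
    ring

/-- The negative binomial weights sum to one. -/
theorem hasSum_pmfActive : HasSum H.pmfActive 1 := by
  have hc := H.meanActive_pos
  set c := H.meanActive with hc_def
  have hx : 0 < 3.5 + c := by positivity
  have hmem : c / (3.5 + c) ∈ Metric.eball (0 : ℝ) 1 := by
    rw [← ENNReal.ofReal_one, Metric.eball_ofReal, mem_ball_zero_iff,
      Real.norm_of_nonneg (by positivity), div_lt_one hx]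
    linarith
  have h := (Real.one_div_one_sub_rpow_hasFPowerSeriesOnBall_zero 3.5).hasSum hmem
  have h1 : 1 - c / (3.5 + c) = 3.5 / (3.5 + c) := by
    field_simp
    ring
  have h2 : (0 : ℝ) < (3.5 / (3.5 + c)) ^ (3.5 : ℝ) := by positivity
  have h3 := h.mul_left ((3.5 / (3.5 + c)) ^ (3.5 : ℝ))
  rw [zero_add, h1, mul_one_div_cancel h2.ne'] at h3
  refine h3.congr_fun fun n => ?_
  have h4 : Real.Gamma 3.5 ≠ 0 := (Real.Gamma_pos_of_pos (by norm_num)).ne'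
  have h5 : (3.5 + c) ^ (-((n : ℝ) + 3.5)) = ((3.5 + c) ^ n)⁻¹ * ((3.5 + c) ^ (3.5 : ℝ))⁻¹ := by
    rw [Real.rpow_neg hx.le, Real.rpow_add hx, Real.rpow_natCast, mul_inv]
  have h6 : (n.factorial : ℝ) ≠ 0 := by positivity
  have h7 : (0 : ℝ) < (3.5 + c) ^ (3.5 : ℝ) := by positivity
  simp only [FormalMultilinearSeries.ofScalars_apply_eq, smul_eq_mul]
  rw [pmfActive, ← hc_def, h5, Gamma_add_nat_eq (by norm_num), Real.div_rpow (by norm_num) hx.le,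
    div_pow]
  field_simp

theorem pmfActive_zero : H.pmfActive 0 = (1 + H.meanActive / 3.5) ^ (-(3.5 : ℝ)) := by
  have hc := H.meanActive_pos
  have h2 : Real.Gamma 3.5 ≠ 0 := (Real.Gamma_pos_of_pos (by norm_num)).ne'
  have h1 : 1 + H.meanActive / 3.5 = (3.5 + H.meanActive) / 3.5 := by
    field_simp
  rw [h1, Real.div_rpow (by positivity) (by norm_num), pmfActive]
  simp only [CharP.cast_eq_zero, zero_add, Nat.factorial_zero, Nat.cast_one, mul_one, pow_zero]
  rw [mul_div_cancel_right₀ _ h2, Real.rpow_neg (x := 3.5) (by norm_num)]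
  field_simp

theorem pmfActiveHat_eq {n : ℕ} (hn : 1 ≤ n) :
    H.pmfActiveHat n = n / H.meanActive * H.pmfActive n := by
  obtain ⟨k, rfl⟩ := Nat.exists_eq_add_of_le' hn
  have hc := H.meanActive_pos
  have h2 : Real.Gamma 3.5 ≠ 0 := (Real.Gamma_pos_of_pos (by norm_num)).ne'
  rw [pmfActiveHat, pmfActive, Nat.cast_add_one, Real.Gamma_nat_eq_factorial, Nat.factorial_succ]
  push_cast
  rw [pow_succ]
  field_simp

theorem prSelected_eq (U : ℕ) :
    H.prSelected U = (U * (1 - ∑ n ∈ Finset.range (U + 1), H.pmfActive n) +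
      ∑ n ∈ Finset.range (U + 1), n * H.pmfActive n) / H.meanActive := by
  have hc := H.meanActive_pos
  have e1 : U * H.lam1 * H.A2 / (H.lam2 * H.A2O) = U / H.meanActive := by
    rw [meanActive]
    field_simp [H.A2_pos.ne']
  have e2 : H.lam2 * H.A2O / (3.5 * H.lam1 * H.A2) = H.meanActive / 3.5 := by
    rw [meanActive]
    field_simp
  have hs : ∀ f : ℕ → ℝ, ∑ n ∈ Finset.range (U + 1), f n = f 0 + ∑ n ∈ Finset.Icc 1 U, f n :=
    fun f => by
      rw [Finset.range_eq_Ico, Finset.sum_eq_sum_Ico_succ_bot (Nat.succ_pos U)]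
      rfl
  rw [prSelected, e1, e2, ← pmfActive_zero, hs, hs]
  have e3 : ∑ n ∈ Finset.Icc 1 U, (U : ℝ) / n * H.pmfActiveHat n =
      U / H.meanActive * ∑ n ∈ Finset.Icc 1 U, H.pmfActive n := by
    rw [Finset.mul_sum]
    refine Finset.sum_congr rfl fun n hn => ?_
    have hn1 := (Finset.mem_Icc.1 hn).1
    have hn0 : (n : ℝ) ≠ 0 := by positivity
    rw [H.pmfActiveHat_eq hn1]
    field_simp
  have e4 : ∑ n ∈ Finset.Icc 1 U, H.pmfActiveHat n =
      (∑ n ∈ Finset.Icc 1 U, n * H.pmfActive n) / H.meanActive := by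
    rw [Finset.sum_div]
    refine Finset.sum_congr rfl fun n hn => ?_
    rw [H.pmfActiveHat_eq (Finset.mem_Icc.1 hn).1]
    ring
  rw [e3, e4, Nat.cast_zero, zero_mul]
  ring

/-- The law `pmfActiveHat` is the size-biased version of `pmfActive`. This turns the increment of
the selection probability into the probability of more than `U` active offloaded users, divided by
their mean number. -/
theorem prSelected_succ_sub (U : ℕ) :
    H.prSelected (U + 1) - H.prSelected U =
      (1 - ∑ n ∈ Finset.range (U + 1), H.pmfActive n) / H.meanActive := by
  rw [prSelected_eq, prSelected_eq, Finset.sum_range_succ _ (U + 1),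
    Finset.sum_range_succ _ (U + 1)]
  push_cast
  ring

theorem prSelected_lt_succ (U : ℕ) : H.prSelected U < H.prSelected (U + 1) := by
  rw [← sub_pos, prSelected_succ_sub]
  refine div_pos (sub_pos.2 ?_) H.meanActive_pos
  have h1 := sum_le_hasSum (Finset.range (U + 2)) (fun n _ => (H.pmfActive_pos n).le)
    H.hasSum_pmfActive
  rw [Finset.sum_range_succ] at h1
  linarith [H.pmfActive_pos (U + 1)]

theorem pmfNulled_self (U : ℕ) : H.pmfNulled U U = ∑' k : ℕ, H.pmfActive (U + k) := by
  simp [pmfNulled]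

theorem summable_pmfActive_add (U : ℕ) : Summable fun k => H.pmfActive (U + k) := by
  simpa only [add_comm U] using (summable_nat_add_iff U).2 H.hasSum_pmfActive.summable

theorem pmfNulled_self_pos (U : ℕ) : 0 < H.pmfNulled U U := by
  rw [pmfNulled_self]
  exact (H.summable_pmfActive_add U).tsum_pos (fun k => (H.pmfActive_pos _).le) 0
    (H.pmfActive_pos _)

theorem pmfNulled_self_eq_add (U : ℕ) :
    H.pmfNulled U U = H.pmfActive U + H.pmfNulled (U + 1) (U + 1) := by
  rw [pmfNulled_self, pmfNulled_self, (H.summable_pmfActive_add U).tsum_eq_zero_add, add_zero]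
  simp only [add_assoc, add_comm 1]

theorem pmfNulled_of_lt {U n : ℕ} (h : n < U) : H.pmfNulled U n = H.pmfActive n := if_pos h

end Params

end HetNet

namespace HetNet

/-! ### The effect of the interference of the nearest macro base station -/

/-- Summation over the third entry of a composition of `n` into three parts. -/
theorem sum_antidiagonalTuple_three (n : ℕ) (a b g : ℕ → ℝ) :
    1 / (n.factorial : ℝ) * ∑ q ∈ Finset.Nat.antidiagonalTuple 3 n,
      (Nat.multinomial Finset.univ q : ℝ) * a (q 0) * b (q 1) * ((q 2).factorial * g (q 2)) =
    ∑ l ∈ Finset.range (n + 1), (1 / (l.factorial : ℝ) *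
      ∑ k ∈ Finset.range (l + 1), (l.choose k : ℝ) * a k * b (l - k)) * g (n - l) := by
  simp only [Finset.mul_sum, Finset.sum_mul]
  rw [Finset.sum_sigma']
  refine Finset.sum_nbij' (fun q => (⟨q 0 + q 1, q 0⟩ : Σ _ : ℕ, ℕ))
    (fun p => ![p.2, p.1 - p.2, n - p.1]) ?_ ?_ ?_ ?_ ?_
  · intro q hq
    rw [Finset.Nat.mem_antidiagonalTuple, Fin.sum_univ_three] at hq
    simp only [Finset.mem_sigma, Finset.mem_range]
    omega
  · rintro ⟨l, k⟩ h
    simp only [Finset.mem_sigma, Finset.mem_range] at h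
    rw [Finset.Nat.mem_antidiagonalTuple, Fin.sum_univ_three]
    simp only [Matrix.cons_val]
    omega
  · intro q hq
    rw [Finset.Nat.mem_antidiagonalTuple, Fin.sum_univ_three] at hq
    ext i
    fin_cases i
    · simp
    · simp
    · simp
      omega
  · rintro ⟨l, k⟩ h
    simp only [Finset.mem_sigma, Finset.mem_range] at h
    have : k + (l - k) = l := by omega
    simp [this]
  · intro q hq
    rw [Finset.Nat.mem_antidiagonalTuple, Fin.sum_univ_three] at hq
    have h1 := Nat.multinomial_spec Finset.univ q
    rw [Fin.prod_univ_three, Fin.sum_univ_three, hq] at h1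
    have h2 := Nat.add_choose_mul_factorial_mul_factorial (q 0) (q 1)
    have h3 : q 0 + q 1 - q 0 = q 1 := by omega
    have h4 : n - (q 0 + q 1) = q 2 := by omega
    rw [← Nat.choose_symm_add] at h2
    rw [h3, h4, ← h1, ← h2]
    have h5 : Nat.multinomial Finset.univ q ≠ 0 := (Nat.multinomial_pos _ _).ne'
    have h6 : (q 0 + q 1).choose (q 0) ≠ 0 := (Nat.choose_pos (by omega)).ne'
    push_cast
    field_simp

/-- A convolution with the geometric law of ratio `t / (1 + t)` lowers the distribution function at
`N - 1` by `∑ T_n (t / (1 + t)) ^ (N - n)`: this is the tail of that law from `N - n` on. -/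
theorem sum_conv_geometric (T : ℕ → ℝ) {t : ℝ} (ht : 1 + t ≠ 0) (N : ℕ) :
    ∑ n ∈ Finset.range N, ∑ l ∈ Finset.range (n + 1),
      T l * (t ^ (n - l) * ((1 + t) ^ (n - l + 1))⁻¹) =
    ∑ n ∈ Finset.range N, T n - ∑ n ∈ Finset.range N, T n * (t / (1 + t)) ^ (N - n) := by
  induction N with
  | zero => simp
  | succ N ih =>
    rw [Finset.sum_range_succ, ih, Finset.sum_range_succ T, Finset.sum_range_succ _ N,
      Finset.sum_range_succ _ N]
    have h : ∀ l ∈ Finset.range N, T l * (t ^ (N - l) * ((1 + t) ^ (N - l + 1))⁻¹) =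
        T l * (t / (1 + t)) ^ (N - l) - T l * (t / (1 + t)) ^ (N + 1 - l) := by
      intro l hl
      rw [Nat.succ_sub (Finset.mem_range.1 hl).le, div_pow, div_pow, pow_succ t, Nat.succ_eq_add_one]
      field_simp
      ring
    rw [Finset.sum_congr rfl h, Finset.sum_sub_distrib]
    have h2 : T N * (t ^ (N - N) * ((1 + t) ^ (N - N + 1))⁻¹) =
        T N - T N * (t / (1 + t)) ^ (N + 1 - N) := by
      rw [Nat.sub_self, Nat.add_sub_cancel_left]
      field_simp
      ring
    rw [h2]
    ring

/-- The coverage summands with the nearest macro base station among the interferers are the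
convolution of those without it and a geometric law. -/
theorem sum_multinomial_eq (a b : ℕ → ℝ) {t : ℝ} (ht : 1 + t ≠ 0) (N : ℕ) :
    ∑ n ∈ Finset.range N, 1 / (n.factorial : ℝ) *
      ∑ q ∈ Finset.Nat.antidiagonalTuple 3 n, (Nat.multinomial Finset.univ q : ℝ) *
        a (q 0) * b (q 1) * Real.Gamma (q 2 + 1) * t ^ q 2 * ((1 + t) ^ (q 2 + 1))⁻¹ =
    ∑ n ∈ Finset.range N, (1 / (n.factorial : ℝ) *
      ∑ k ∈ Finset.range (n + 1), (n.choose k : ℝ) * a k * b (n - k)) -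
    ∑ n ∈ Finset.range N, (1 / (n.factorial : ℝ) *
      ∑ k ∈ Finset.range (n + 1), (n.choose k : ℝ) * a k * b (n - k)) *
        (t / (1 + t)) ^ (N - n) := by
  rw [← sum_conv_geometric _ ht]
  refine Finset.sum_congr rfl fun n _ => ?_
  rw [← sum_antidiagonalTuple_three n a b fun j => t ^ j * ((1 + t) ^ (j + 1))⁻¹]
  congr 1
  refine Finset.sum_congr rfl fun q _ => ?_
  rw [Real.Gamma_nat_eq_factorial]
  ring

namespace Params

variable (H : Params)

/-! ### Macro-users -/

/-- A summand of a coverage probability is exactly of order `β ^ m`. -/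
theorem sum_laplaceD_eq (m : ℕ) {β κ₁ κ₂ s₁ s₂ r₁ r₂ : ℝ} (hs₁ : 0 < s₁) (hs₂ : 0 < s₂)
    (hr₁ : 0 < r₁) (hr₂ : 0 < r₂) (h₁ : s₁ * r₁ ^ (-H.alpha1) = β * κ₁)
    (h₂ : s₂ * r₂ ^ (-H.alpha2) = β * κ₂) :
    1 / (m.factorial : ℝ) * ∑ k ∈ Finset.range (m + 1), (m.choose k : ℝ) *
        laplaceD H.lam1 H.alpha1 k s₁ r₁ * laplaceD H.lam2 H.alpha2 (m - k) s₂ r₂ =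
      β ^ m * H.coverCore m β κ₁ κ₂ (r₁ ^ 2) (r₂ ^ 2) := by
  rw [coverCore, mul_left_comm, Finset.mul_sum _ _ (β ^ m)]
  congr 1
  refine Finset.sum_congr rfl fun k hk => ?_
  have hk' : k ≤ m := Nat.lt_succ_iff.1 (Finset.mem_range.1 hk)
  rw [laplaceD_eq H.two_lt_alpha1 k hs₁ hr₁, laplaceD_eq H.two_lt_alpha2 (m - k) hs₂ hr₂, h₁, h₂,
    mul_pow, mul_pow]
  nth_rw 5 [← Nat.add_sub_cancel' hk']
  rw [pow_add]
  ring

/-- Lower bound for the distance from a macro-user to the nearest pico base station. -/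
noncomputable def macroExcl (y : ℝ) : ℝ :=
  (H.P2 * H.B / H.P1) ^ (1 / H.alpha2) * y ^ (H.alpha1 / H.alpha2)

theorem PB_pos : 0 < H.P2 * H.B / H.P1 := div_pos (mul_pos H.P2_pos H.B_pos) H.P1_pos

theorem macroExcl_pos {y : ℝ} (hy : 0 < y) : 0 < H.macroExcl y :=
  mul_pos (Real.rpow_pos_of_pos H.PB_pos _) (Real.rpow_pos_of_pos hy _)

theorem macroExcl_sq {y : ℝ} (hy : 0 < y) : H.macroExcl y ^ 2 =
    (H.P2 * H.B / H.P1) ^ (2 / H.alpha2) * y ^ (2 * H.alpha1 / H.alpha2) := by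
  rw [macroExcl, mul_pow, ← Real.rpow_natCast, ← Real.rpow_natCast, ← Real.rpow_mul H.PB_pos.le,
    ← Real.rpow_mul hy.le]
  congr 2 <;> push_cast <;> ring

theorem macroExcl_rpow {y : ℝ} (hy : 0 < y) : H.macroExcl y ^ (-H.alpha2) =
    (H.P2 * H.B / H.P1)⁻¹ * y ^ (-H.alpha1) := by
  have := H.alpha2_pos.ne'
  rw [macroExcl, Real.mul_rpow (Real.rpow_nonneg H.PB_pos.le _) (Real.rpow_nonneg hy.le _),
    ← Real.rpow_mul H.PB_pos.le, ← Real.rpow_mul hy.le]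
  have e1 : 1 / H.alpha2 * -H.alpha2 = -1 := by field_simp
  have e2 : H.alpha1 / H.alpha2 * -H.alpha2 = -H.alpha1 := by field_simp
  rw [e1, e2, Real.rpow_neg_one]

theorem fY1_pos {y : ℝ} (hy : 0 < y) : 0 < H.fY1 y := by
  have := H.A1_pos
  have := H.lam1_pos
  have := Real.pi_pos
  unfold fY1
  positivity

theorem integrable_fY1 : Integrable (fun y => H.fY1 y *
    Real.exp (Real.pi * min (H.lam1 / 2) H.lam2 * (y ^ 2 + H.macroExcl y ^ 2)))
    (volume.restrict (Set.Ioi 0)) := by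
  have hl := H.lam1_pos
  have hA := H.A1_pos
  have hpi := Real.pi_pos
  have hdom : Integrable (fun y : ℝ => 2 * Real.pi * H.lam1 / H.A1 *
      (y * Real.exp (-(Real.pi * H.lam1 / 2) * y ^ 2))) (volume.restrict (Set.Ioi 0)) :=
    ((integrable_mul_exp_neg_mul_sq (by positivity)).const_mul _).restrict
  refine hdom.mono' ?_ ?_
  · have : Measurable fun y => H.fY1 y *
        Real.exp (Real.pi * min (H.lam1 / 2) H.lam2 * (y ^ 2 + H.macroExcl y ^ 2)) := by
      unfold fY1 macroExcl
      fun_prop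
    exact this.aestronglyMeasurable
  · filter_upwards [ae_restrict_mem measurableSet_Ioi] with y (hy : 0 < y)
    have hf := H.fY1_pos hy
    rw [Real.norm_of_nonneg (by positivity), fY1, mul_assoc, mul_assoc (2 * Real.pi * H.lam1 / H.A1),
      ← Real.exp_add, mul_assoc H.lam2, ← H.macroExcl_sq hy]
    refine mul_le_mul_of_nonneg_left (mul_le_mul_of_nonneg_left (Real.exp_le_exp.2 ?_) hy.le)
      (by positivity)
    have h1 := mul_le_mul_of_nonneg_right (min_le_left (H.lam1 / 2) H.lam2)
      (show 0 ≤ Real.pi * y ^ 2 by positivity)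
    have h2 := mul_le_mul_of_nonneg_right (min_le_right (H.lam1 / 2) H.lam2)
      (show 0 ≤ Real.pi * H.macroExcl y ^ 2 by positivity)
    linarith

/-- The geometry of a macro-user at distance `y` from the serving base station. -/
noncomputable def macroGeometry : Geometry ℝ where
  μ := volume.restrict (Set.Ioi 0)
  κ₁ _ := 1
  κ₂ _ := H.rho2 / H.rho1 * (H.P2 * H.B / H.P1)⁻¹
  v₁ y := y ^ 2
  v₂ y := H.macroExcl y ^ 2
  w := H.fY1
  K := max 1 (H.rho2 / H.rho1 * (H.P2 * H.B / H.P1)⁻¹)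
  δ := Real.pi * min (H.lam1 / 2) H.lam2
  measurable_κ₁ := measurable_const
  measurable_κ₂ := measurable_const
  measurable_v₁ := by fun_prop
  measurable_v₂ := by
    unfold macroExcl
    fun_prop
  measurable_w := by
    unfold fY1
    fun_prop
  δ_pos := mul_pos Real.pi_pos (lt_min (half_pos H.lam1_pos) H.lam2_pos)
  μ_ne_zero := by
    rw [Ne, Measure.restrict_eq_zero]
    simp
  ae_pos := by
    filter_upwards [ae_restrict_mem measurableSet_Ioi] with y (hy : 0 < y)
    exact ⟨one_pos, mul_pos (div_pos H.rho2_pos H.rho1_pos) (inv_pos.2 H.PB_pos), by positivity,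
      pow_pos (H.macroExcl_pos hy) 2, H.fY1_pos hy⟩
  ae_le := Eventually.of_forall fun _ => ⟨le_max_left _ _, le_max_right _ _⟩
  integrable_w := H.integrable_fY1

/-- Coverage probability of a macro-user whose base station keeps `M` degrees of freedom, as a
polynomial in `β` with analytic coefficients. -/
theorem integral_macro_eq {M : ℕ} {β : ℝ} (hβ : 0 < β)
    (hint : ∀ n < M, Integrable (H.macroGeometry.coverIntegrand H n 0 β) H.macroGeometry.μ) :
    (∫ y in Set.Ioi (0 : ℝ),
      (∑ n ∈ Finset.range M, 1 / (n.factorial : ℝ) *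
        ∑ k ∈ Finset.range (n + 1), (n.choose k : ℝ) *
          laplaceD H.lam1 H.alpha1 k (β * y ^ H.alpha1) y *
          laplaceD H.lam2 H.alpha2 (n - k) (β * y ^ H.alpha1 * (H.rho2 / H.rho1))
            ((H.P2 * H.B / H.P1) ^ (1 / H.alpha2) * y ^ (H.alpha1 / H.alpha2))) *
        H.fY1 y) =
      ∑ n ∈ Finset.range M, β ^ n * H.macroGeometry.coverMean H n 0 β := by
  have hpt : ∀ y ∈ Set.Ioi (0 : ℝ),
      (∑ n ∈ Finset.range M, 1 / (n.factorial : ℝ) *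
        ∑ k ∈ Finset.range (n + 1), (n.choose k : ℝ) *
          laplaceD H.lam1 H.alpha1 k (β * y ^ H.alpha1) y *
          laplaceD H.lam2 H.alpha2 (n - k) (β * y ^ H.alpha1 * (H.rho2 / H.rho1))
            ((H.P2 * H.B / H.P1) ^ (1 / H.alpha2) * y ^ (H.alpha1 / H.alpha2))) *
        H.fY1 y =
      ∑ n ∈ Finset.range M, β ^ n * H.macroGeometry.coverIntegrand H n 0 β y := by
    intro y (hy : 0 < y)
    have hr1 := H.rho1_pos
    have hr2 := H.rho2_pos
    have hya := Real.rpow_pos_of_pos hy H.alpha1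
    rw [Finset.sum_mul]
    refine Finset.sum_congr rfl fun n _ => ?_
    have h1 : β * y ^ H.alpha1 * y ^ (-H.alpha1) = β * 1 := by
      rw [mul_assoc, ← Real.rpow_add hy]
      simp
    have h2 : β * y ^ H.alpha1 * (H.rho2 / H.rho1) * H.macroExcl y ^ (-H.alpha2) =
        β * (H.rho2 / H.rho1 * (H.P2 * H.B / H.P1)⁻¹) := by
      rw [H.macroExcl_rpow hy]
      calc _ = β * y ^ H.alpha1 * y ^ (-H.alpha1) *
            (H.rho2 / H.rho1 * (H.P2 * H.B / H.P1)⁻¹) := by ring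
        _ = _ := by rw [h1, mul_one]
    have h3 := H.sum_laplaceD_eq n (by positivity) (by positivity) hy (H.macroExcl_pos hy) h1 h2
    rw [macroExcl] at h3
    rw [h3, Geometry.coverIntegrand, pow_zero, mul_one, mul_assoc]
    rfl
  rw [setIntegral_congr_fun measurableSet_Ioi hpt, integral_finsetSum]
  · simp only [integral_const_mul]
    rfl
  · intro n hn
    exact (hint n (Finset.mem_range.1 hn)).const_mul _

/-- Passing from `U` to `U + 1` affects a macro-user only if at least `U + 1` offloaded users are
active. Then its base station loses one degree of freedom, and with it the last summand of the
coverage probability. -/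
theorem S1_succ_sub {U : ℕ} (hU : U + 1 < H.N1) :
    ∀ᶠ β in 𝓝[>] (0 : ℝ), H.S1 (U + 1) β - H.S1 U β = -(H.pmfNulled (U + 1) (U + 1) *
      (β ^ (H.N1 - (U + 1)) * H.macroGeometry.coverMean H (H.N1 - (U + 1)) 0 β)) := by
  have hev := (Finset.eventually_all (Finset.range H.N1)).2 fun n _ =>
    H.macroGeometry.eventually_integrable H n 0
  filter_upwards [nhdsWithin_le_nhds hev, self_mem_nhdsWithin] with β hint hβ
  have hI : ∀ u, H.N1 - u ≤ H.N1 := fun u => Nat.sub_le _ _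
  have hS := fun u => H.integral_macro_eq (M := H.N1 - u) hβ fun n hn =>
    hint n (Finset.mem_range.2 (hn.trans_le (hI u)))
  simp only [S1, hS]
  rw [Finset.sum_range_succ _ (U + 1), Finset.sum_range_succ _ U, Finset.sum_range_succ _ U]
  have e : ∀ V, U ≤ V → ∑ u ∈ Finset.range U, (∑ n ∈ Finset.range (H.N1 - u),
      β ^ n * H.macroGeometry.coverMean H n 0 β) * H.pmfNulled V u =
      ∑ u ∈ Finset.range U, (∑ n ∈ Finset.range (H.N1 - u),
      β ^ n * H.macroGeometry.coverMean H n 0 β) * H.pmfActive u := by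
    intro V hV
    refine Finset.sum_congr rfl fun u hu => ?_
    rw [H.pmfNulled_of_lt ((Finset.mem_range.1 hu).trans_le hV)]
  rw [e U le_rfl, e (U + 1) (Nat.le_succ U), H.pmfNulled_of_lt (Nat.lt_succ_self U),
    H.pmfNulled_self_eq_add U, show H.N1 - U = H.N1 - (U + 1) + 1 by omega,
    Finset.sum_range_succ _ (H.N1 - (U + 1))]
  ring

end Params

end HetNet

namespace HetNet

namespace Params

variable (H : Params)

/-! ### Offloaded users -/

/-- The possible pairs of distances from an offloaded user to the nearest macro and the nearest
pico base station. -/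
def offRegion : Set (ℝ × ℝ) :=
  {z | 0 < z.1 ∧ H.offLower z.1 < z.2 ∧ z.2 ≤ H.offUpper z.1}

theorem measurable_offLower : Measurable H.offLower := by
  unfold offLower
  fun_prop

theorem measurable_offUpper : Measurable H.offUpper := by
  unfold offUpper
  fun_prop

theorem measurableSet_offRegion : MeasurableSet H.offRegion := by
  have h1 := H.measurable_offLower
  have h2 := H.measurable_offUpper
  exact (measurableSet_lt measurable_const measurable_fst).inter
    ((measurableSet_lt (h1.comp measurable_fst) measurable_snd).inter
      (measurableSet_le measurable_snd (h2.comp measurable_fst)))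

theorem offLower_pos {x : ℝ} (hx : 0 < x) : 0 < H.offLower x :=
  mul_pos (Real.rpow_pos_of_pos (div_pos H.P2_pos H.P1_pos) _) (Real.rpow_pos_of_pos hx _)

theorem offLower_lt_offUpper {x : ℝ} (hx : 0 < x) : H.offLower x < H.offUpper x := by
  have hP := H.P1_pos
  have hP2 := H.P2_pos
  refine mul_lt_mul_of_pos_right (Real.rpow_lt_rpow (by positivity) ?_
    (one_div_pos.2 H.alpha2_pos)) (Real.rpow_pos_of_pos hx _)
  rw [div_lt_div_iff_of_pos_right hP]
  exact lt_mul_of_one_lt_left hP2 H.one_lt_B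

theorem snd_pos_of_mem_offRegion {z : ℝ × ℝ} (hz : z ∈ H.offRegion) : 0 < z.2 :=
  (H.offLower_pos hz.1).trans hz.2.1

theorem offUpper_rpow {x : ℝ} (hx : 0 < x) :
    H.offUpper x ^ H.alpha2 = H.B * H.P2 / H.P1 * x ^ H.alpha1 := by
  have hP := H.P1_pos
  have hP2 := H.P2_pos
  have hB := H.B_pos
  have hc : 0 ≤ H.B * H.P2 / H.P1 := by positivity
  have ha := H.alpha2_pos.ne'
  rw [offUpper, Real.mul_rpow (by positivity) (by positivity), ← Real.rpow_mul hc,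
    ← Real.rpow_mul hx.le, div_mul_cancel₀ _ ha, div_mul_cancel₀ _ ha, Real.rpow_one]

theorem volume_offRegion_pos : 0 < volume H.offRegion := by
  have ha : 0 ≤ H.alpha1 / H.alpha2 := (div_pos H.alpha1_pos H.alpha2_pos).le
  have h1 : Continuous H.offLower := continuous_const.mul (Real.continuous_rpow_const ha)
  have h2 : Continuous H.offUpper := continuous_const.mul (Real.continuous_rpow_const ha)
  obtain ⟨y, hy1, hy2⟩ := exists_between (H.offLower_lt_offUpper one_pos)
  refine Measure.measure_pos_of_mem_nhds _ (x := ((1 : ℝ), y)) ?_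
  have c1 : ContinuousAt (fun z : ℝ × ℝ => H.offLower z.1) (1, y) :=
    (h1.comp continuous_fst).continuousAt
  have c2 : ContinuousAt (fun z : ℝ × ℝ => H.offUpper z.1) (1, y) :=
    (h2.comp continuous_fst).continuousAt
  filter_upwards [continuousAt_const.eventually_lt (continuousAt_fst (p := ((1 : ℝ), y)))
    (show (0 : ℝ) < 1 from one_pos), c1.eventually_lt continuousAt_snd hy1,
    continuousAt_snd.eventually_lt c2 hy2] with z h1 h2 h3 using ⟨h1, h2, h3.le⟩

theorem fY12_pos {x y : ℝ} (hx : 0 < x) (hy : 0 < y) : 0 < H.fY12 x y := by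
  have := H.A2O_pos
  have := H.lam1_pos
  have := H.lam2_pos
  have := Real.pi_pos
  unfold fY12
  positivity

theorem integrable_fY12 : Integrable (fun z : ℝ × ℝ => H.fY12 z.1 z.2 *
    Real.exp (Real.pi * min (H.lam1 / 2) (H.lam2 / 2) * (z.1 ^ 2 + z.2 ^ 2)))
    (volume.restrict H.offRegion) := by
  have hl := H.lam1_pos
  have hl2 := H.lam2_pos
  have hA := H.A2O_pos
  have hpi := Real.pi_pos
  have hdom : Integrable (fun z : ℝ × ℝ => 4 * Real.pi ^ 2 * H.lam1 * H.lam2 / H.A2O *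
      (z.1 * Real.exp (-(Real.pi * H.lam1 / 2) * z.1 ^ 2) *
        (z.2 * Real.exp (-(Real.pi * H.lam2 / 2) * z.2 ^ 2)))) (volume.restrict H.offRegion) :=
    (((integrable_mul_exp_neg_mul_sq (by positivity)).mul_prod
      (integrable_mul_exp_neg_mul_sq (by positivity))).const_mul _).restrict
  refine hdom.mono' ?_ ?_
  · have : Measurable fun z : ℝ × ℝ => H.fY12 z.1 z.2 *
        Real.exp (Real.pi * min (H.lam1 / 2) (H.lam2 / 2) * (z.1 ^ 2 + z.2 ^ 2)) := by
      unfold fY12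
      fun_prop
    exact this.aestronglyMeasurable
  · filter_upwards [ae_restrict_mem H.measurableSet_offRegion] with z hz
    have hx := hz.1
    have hy := H.snd_pos_of_mem_offRegion hz
    have hf := H.fY12_pos hx hy
    rw [Real.norm_of_nonneg (by positivity), fY12, mul_assoc, ← Real.exp_add, mul_mul_mul_comm z.1,
      ← Real.exp_add, mul_assoc _ z.1, mul_assoc _ (z.1 * z.2)]
    refine mul_le_mul_of_nonneg_left (mul_le_mul_of_nonneg_left (Real.exp_le_exp.2 ?_)
      (by positivity)) (by positivity)
    have h1 := mul_le_mul_of_nonneg_right (min_le_left (H.lam1 / 2) (H.lam2 / 2))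
      (show 0 ≤ Real.pi * z.1 ^ 2 by positivity)
    have h2 := mul_le_mul_of_nonneg_right (min_le_right (H.lam1 / 2) (H.lam2 / 2))
      (show 0 ≤ Real.pi * z.2 ^ 2 by positivity)
    linarith

/-- The geometry of an offloaded user at distances `(x, y)` from the nearest macro and the nearest
pico base station. -/
noncomputable def offGeometry : Geometry (ℝ × ℝ) where
  μ := volume.restrict H.offRegion
  κ₁ z := H.rho1 * z.2 ^ H.alpha2 / (H.rho2 * z.1 ^ H.alpha1)
  κ₂ _ := 1
  v₁ z := z.1 ^ 2
  v₂ z := z.2 ^ 2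
  w z := H.fY12 z.1 z.2
  K := max (H.rho1 / H.rho2 * (H.B * H.P2 / H.P1)) 1
  δ := Real.pi * min (H.lam1 / 2) (H.lam2 / 2)
  measurable_κ₁ := by fun_prop
  measurable_κ₂ := measurable_const
  measurable_v₁ := by fun_prop
  measurable_v₂ := by fun_prop
  measurable_w := by
    unfold fY12
    fun_prop
  δ_pos := mul_pos Real.pi_pos (lt_min (half_pos H.lam1_pos) (half_pos H.lam2_pos))
  μ_ne_zero := by
    rw [Ne, Measure.restrict_eq_zero]
    exact H.volume_offRegion_pos.ne'
  ae_pos := by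
    filter_upwards [ae_restrict_mem H.measurableSet_offRegion] with z hz
    have hx := hz.1
    have hy := H.snd_pos_of_mem_offRegion hz
    have h1 := H.rho1_pos
    have h2 := H.rho2_pos
    exact ⟨by positivity, one_pos, by positivity, by positivity, H.fY12_pos hx hy⟩
  ae_le := by
    filter_upwards [ae_restrict_mem H.measurableSet_offRegion] with z hz
    refine ⟨le_max_of_le_left ?_, le_max_right _ _⟩
    have hx := hz.1
    have hy := H.snd_pos_of_mem_offRegion hz
    have h1 := H.rho1_pos
    have h2 := H.rho2_pos
    have h3 := Real.rpow_le_rpow hy.le hz.2.2 H.alpha2_pos.le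
    rw [H.offUpper_rpow hx] at h3
    have h4 := Real.rpow_pos_of_pos hx H.alpha1
    rw [div_le_iff₀ (by positivity)]
    calc H.rho1 * z.2 ^ H.alpha2 ≤ H.rho1 * (H.B * H.P2 / H.P1 * z.1 ^ H.alpha1) := by gcongr
      _ = _ := by field_simp
  integrable_w := H.integrable_fY12

theorem integral_offRegion {f : ℝ → ℝ → ℝ}
    (hf : IntegrableOn (fun z : ℝ × ℝ => f z.1 z.2) H.offRegion) :
    ∫ x in Set.Ioi (0 : ℝ), ∫ y in (H.offLower x)..(H.offUpper x), f x y =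
      ∫ z in H.offRegion, f z.1 z.2 := by
  rw [← integral_indicator H.measurableSet_offRegion, Measure.volume_eq_prod,
    integral_prod _ (by
      rw [← Measure.volume_eq_prod]
      exact (integrable_indicator_iff H.measurableSet_offRegion).2 hf),
    ← integral_indicator measurableSet_Ioi]
  congr 1
  ext x
  by_cases hx : 0 < x
  · rw [Set.indicator_of_mem (Set.mem_Ioi.2 hx),
      intervalIntegral.integral_of_le (H.offLower_lt_offUpper hx).le,
      ← integral_indicator measurableSet_Ioc]
    congr 1
    ext y
    simp [Set.indicator, offRegion, hx]
  · rw [Set.indicator_of_notMem (by simpa using hx)]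
    have : ∀ y, Set.indicator H.offRegion (fun z : ℝ × ℝ => f z.1 z.2) (x, y) = 0 := fun y =>
      Set.indicator_of_notMem (fun h => hx h.1) _
    simp [this]

/-- Not being selected for interference nulling costs an offloaded user a term of exact order
`β ^ N2`: the `n`-th summand, of order `β ^ n`, is lost with a probability of order
`β ^ (N2 - n)`. -/
theorem S2OC_sub_S2OCbar : ∀ᶠ β in 𝓝[>] (0 : ℝ), H.S2OC β - H.S2OCbar β =
    β ^ H.N2 * ∑ n ∈ Finset.range H.N2, H.offGeometry.coverMean H n (H.N2 - n) β := by
  have hev := (Finset.eventually_all (Finset.range H.N2)).2 fun n _ =>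
    (H.offGeometry.eventually_integrable H n 0).and
      (H.offGeometry.eventually_integrable H n (H.N2 - n))
  filter_upwards [nhdsWithin_le_nhds hev, self_mem_nhdsWithin] with β hint (hβ : 0 < β)
  let F₁ : ℝ → ℝ → ℝ := fun x y =>
    (∑ n ∈ Finset.range H.N2, 1 / (n.factorial : ℝ) *
      ∑ k ∈ Finset.range (n + 1), (n.choose k : ℝ) *
        laplaceD H.lam1 H.alpha1 k (β * y ^ H.alpha2 * (H.rho1 / H.rho2)) x *
        laplaceD H.lam2 H.alpha2 (n - k) (β * y ^ H.alpha2) y) * H.fY12 x y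
  let F₂ : ℝ → ℝ → ℝ := fun x y =>
    (∑ n ∈ Finset.range H.N2, 1 / (n.factorial : ℝ) *
      ∑ q ∈ Finset.Nat.antidiagonalTuple 3 n, (Nat.multinomial Finset.univ q : ℝ) *
        laplaceD H.lam1 H.alpha1 (q 0) (β * y ^ H.alpha2 * (H.rho1 / H.rho2)) x *
        laplaceD H.lam2 H.alpha2 (q 1) (β * y ^ H.alpha2) y *
        Real.Gamma (q 2 + 1) *
        (β * (H.rho1 * y ^ H.alpha2 / (H.rho2 * x ^ H.alpha1))) ^ q 2 *
        ((1 + β * (H.rho1 * y ^ H.alpha2 / (H.rho2 * x ^ H.alpha1))) ^ (q 2 + 1))⁻¹) *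
      H.fY12 x y
  have hterm : ∀ z ∈ H.offRegion, ∀ n, 1 / (n.factorial : ℝ) *
      ∑ k ∈ Finset.range (n + 1), (n.choose k : ℝ) *
        laplaceD H.lam1 H.alpha1 k (β * z.2 ^ H.alpha2 * (H.rho1 / H.rho2)) z.1 *
        laplaceD H.lam2 H.alpha2 (n - k) (β * z.2 ^ H.alpha2) z.2 =
      β ^ n * H.coverCore n β (H.offGeometry.κ₁ z) (H.offGeometry.κ₂ z) (H.offGeometry.v₁ z)
        (H.offGeometry.v₂ z) := by
    intro z hz n
    have hx := hz.1
    have hy := H.snd_pos_of_mem_offRegion hz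
    have h1 := H.rho1_pos
    have h2 := H.rho2_pos
    refine H.sum_laplaceD_eq n (by positivity) (by positivity) hx hy ?_ ?_
    · rw [Real.rpow_neg hx.le]
      simp only [offGeometry]
      have := Real.rpow_pos_of_pos hx H.alpha1
      field_simp
    · rw [mul_assoc, ← Real.rpow_add hy]
      simp [offGeometry]
  have hF₁ : ∀ z ∈ H.offRegion, F₁ z.1 z.2 =
      ∑ n ∈ Finset.range H.N2, β ^ n * H.offGeometry.coverIntegrand H n 0 β z := by
    intro z hz
    simp only [F₁]
    rw [Finset.sum_mul]
    refine Finset.sum_congr rfl fun n _ => ?_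
    rw [hterm z hz, Geometry.coverIntegrand, pow_zero, mul_one, mul_assoc]
    rfl
  have hF₂ : ∀ z ∈ H.offRegion, F₂ z.1 z.2 = F₁ z.1 z.2 -
      ∑ n ∈ Finset.range H.N2, β ^ H.N2 * H.offGeometry.coverIntegrand H n (H.N2 - n) β z := by
    intro z hz
    have hx := hz.1
    have hy := H.snd_pos_of_mem_offRegion hz
    have h1 := H.rho1_pos
    have h2 := H.rho2_pos
    have hκ : 0 < H.offGeometry.κ₁ z := by
      simp only [offGeometry]
      positivity
    have ht : 1 + β * (H.rho1 * z.2 ^ H.alpha2 / (H.rho2 * z.1 ^ H.alpha1)) ≠ 0 := by positivity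
    simp only [F₁, F₂]
    rw [sum_multinomial_eq
      (fun k => laplaceD H.lam1 H.alpha1 k (β * z.2 ^ H.alpha2 * (H.rho1 / H.rho2)) z.1)
      (fun k => laplaceD H.lam2 H.alpha2 k (β * z.2 ^ H.alpha2) z.2) ht,
      sub_mul, Finset.sum_mul _ _ (H.fY12 z.1 z.2), Finset.sum_mul]
    congr 1
    refine Finset.sum_congr rfl fun n hn => ?_
    rw [hterm z hz, Geometry.coverIntegrand, mul_div_assoc, mul_pow]
    have hN : β ^ H.N2 = β ^ n * β ^ (H.N2 - n) := by
      rw [← pow_add, Nat.add_sub_cancel' (Finset.mem_range.1 hn).le]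
    rw [hN]
    simp only [offGeometry]
    ring
  have hi₁ : IntegrableOn (fun z : ℝ × ℝ => F₁ z.1 z.2) H.offRegion :=
    (integrableOn_congr_fun hF₁ H.measurableSet_offRegion).2
      (integrable_finsetSum _ fun n hn => (hint n hn).1.const_mul _)
  have hi₃ : IntegrableOn (fun z => ∑ n ∈ Finset.range H.N2,
      β ^ H.N2 * H.offGeometry.coverIntegrand H n (H.N2 - n) β z) H.offRegion :=
    integrable_finsetSum _ fun n hn => (hint n hn).2.const_mul _
  have hi₂ : IntegrableOn (fun z : ℝ × ℝ => F₂ z.1 z.2) H.offRegion :=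
    (integrableOn_congr_fun hF₂ H.measurableSet_offRegion).2 (hi₁.sub hi₃)
  have e₁ : H.S2OC β = ∫ z in H.offRegion, F₁ z.1 z.2 := H.integral_offRegion hi₁
  have e₂ : H.S2OCbar β = ∫ z in H.offRegion, F₂ z.1 z.2 := H.integral_offRegion hi₂
  rw [e₁, e₂, setIntegral_congr_fun H.measurableSet_offRegion hF₂, integral_sub hi₁ hi₃,
    sub_sub_cancel, integral_finsetSum]
  · simp only [integral_const_mul, ← Finset.mul_sum]
    rfl
  · intro n hn
    exact (hint n hn).2.const_mul _

end Params

end HetNet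

namespace HetNet

/-! ### Signs and unimodality -/

/-- A real analytic function has a constant sign to the right of each point. -/
theorem eventually_sign_of_analyticAt {f : ℝ → ℝ} (hf : AnalyticAt ℝ f 0) :
    (∀ᶠ τ in 𝓝[>] (0 : ℝ), 0 < f τ) ∨ (∀ᶠ τ in 𝓝[>] (0 : ℝ), f τ = 0) ∨
      ∀ᶠ τ in 𝓝[>] (0 : ℝ), f τ < 0 := by
  by_cases h0 : ∀ᶠ τ in 𝓝 (0 : ℝ), f τ = 0
  · exact Or.inr (Or.inl (nhdsWithin_le_nhds h0))
  · obtain ⟨n, g, hg, hg0, hfg⟩ := hf.exists_eventuallyEq_pow_smul_nonzero_iff.2 h0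
    rcases hg0.lt_or_gt with h | h
    · refine Or.inr (Or.inr ?_)
      filter_upwards [nhdsWithin_le_nhds hfg, self_mem_nhdsWithin,
        nhdsWithin_le_nhds (hg.continuousAt.eventually_lt_const h)] with τ h1 (h2 : 0 < τ) h3
      rw [h1, sub_zero, smul_eq_mul]
      exact mul_neg_of_pos_of_neg (pow_pos h2 n) h3
    · refine Or.inl ?_
      filter_upwards [nhdsWithin_le_nhds hfg, self_mem_nhdsWithin,
        nhdsWithin_le_nhds (hg.continuousAt.eventually_const_lt h)] with τ h1 (h2 : 0 < τ) h3
      rw [h1, sub_zero, smul_eq_mul]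
      exact mul_pos (pow_pos h2 n) h3

/-- The maximizers of a function that increases up to `a`, is constant up to `b`, and decreases
afterwards. -/
theorem setOf_isMax_eq_Icc (R : ℕ → ℝ) {N a b : ℕ} (hab : a ≤ b) (hb : b < N)
    (hinc : ∀ U < a, R U < R (U + 1)) (hconst : ∀ U, a ≤ U → U < b → R (U + 1) = R U)
    (hdec : ∀ U, b ≤ U → U + 1 < N → R (U + 1) < R U) :
    {U | U < N ∧ ∀ V < N, R V ≤ R U} = Set.Icc a b := by
  have h1 : ∀ V, V < a → R V < R a := fun V hV =>
    strictMonoOn_of_lt_add_one (s := Set.Iic a) Set.ordConnected_Iic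
      (fun U _ _ hU => hinc U hU) hV.le (Set.self_mem_Iic) hV
  have h2 : ∀ V, a ≤ V → V ≤ b → R V = R a := fun V hV =>
    Nat.le_induction (fun _ => rfl)
      (fun U hU ih hU' => (hconst U hU hU').trans (ih (Nat.le_of_succ_le hU'))) V hV
  have h3 : ∀ V, b < V → V < N → R V < R a := by
    intro V hV
    induction V, hV using Nat.le_induction with
    | base =>
      intro h
      rw [← h2 b hab le_rfl]
      exact hdec b le_rfl h
    | succ U hU ih =>
      intro h
      exact (hdec U (Nat.le_of_succ_le hU) h).trans (ih (by omega))
  ext U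
  refine ⟨fun ⟨hU, hmax⟩ => ?_, fun ⟨hU1, hU2⟩ => ⟨hU2.trans_lt hb, fun V hV => ?_⟩⟩
  · have := hmax a (hab.trans_lt hb)
    by_contra hcon
    rw [Set.mem_Icc, not_and_or, not_le, not_le] at hcon
    rcases hcon with h | h
    · exact (h1 U h).not_ge this
    · exact (h3 U h hU).not_ge this
  · rw [h2 U hU1 hU2]
    rcases lt_or_ge V a with h | h
    · exact (h1 V h).le
    rcases le_or_gt V b with h' | h'
    · exact (h2 V h h').le
    · exact (h3 V h' hV).le

/-! ### From the rate threshold to the SIR threshold -/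

section SIR

variable {c : ℝ}

theorem analyticAt_rateToSIR_mul (c : ℝ) : AnalyticAt ℝ (fun τ => rateToSIR (c * τ)) 0 := by
  simp only [rateToSIR, Real.rpow_def_of_pos two_pos]
  exact (analyticAt_const.mul (analyticAt_const.mul analyticAt_id)).rexp.sub analyticAt_const

theorem rateToSIR_zero : rateToSIR 0 = 0 := by simp [rateToSIR]

theorem rateToSIR_pos {x : ℝ} (hx : 0 < x) : 0 < rateToSIR x :=
  sub_pos.2 (Real.one_lt_rpow one_lt_two hx)

theorem tendsto_rateToSIR_mul (hc : 0 < c) :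
    Tendsto (fun τ => rateToSIR (c * τ)) (𝓝[>] 0) (𝓝[>] 0) := by
  refine tendsto_nhdsWithin_iff.2 ⟨?_, ?_⟩
  · have h := (analyticAt_rateToSIR_mul c).continuousAt.tendsto
    simp only [mul_zero, rateToSIR_zero] at h
    exact h.mono_left nhdsWithin_le_nhds
  · filter_upwards [self_mem_nhdsWithin] with τ (hτ : 0 < τ)
    exact rateToSIR_pos (mul_pos hc hτ)

theorem tendsto_rateToSIR_mul_div (c : ℝ) :
    Tendsto (fun τ => rateToSIR (c * τ) / τ) (𝓝[>] 0) (𝓝 (c * Real.log 2)) := by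
  have h : HasDerivAt (fun τ : ℝ => rateToSIR (c * τ)) (c * Real.log 2) 0 := by
    have h1 := ((hasDerivAt_id (0 : ℝ)).const_mul c).const_rpow (a := 2) two_pos
    simpa [rateToSIR, mul_comm] using h1.sub_const 1
  have h2 := (hasDerivAt_iff_tendsto_slope.1 h).mono_left
    (nhdsWithin_mono 0 (fun x (hx : 0 < x) => hx.ne' : Set.Ioi (0 : ℝ) ⊆ {0}ᶜ))
  refine h2.congr fun τ => ?_
  simp [slope_def_field, rateToSIR_zero]

theorem tendsto_rateToSIR_pow_mul_div (hc : 0 < c) {Z : ℝ → ℝ} (hZ : ContinuousAt Z 0) (n k : ℕ) :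
    Tendsto (fun τ => rateToSIR (c * τ) ^ (n + k) * Z (rateToSIR (c * τ)) / τ ^ n) (𝓝[>] 0)
      (𝓝 ((c * Real.log 2) ^ n * 0 ^ k * Z 0)) := by
  have h1 := (tendsto_rateToSIR_mul hc).mono_right nhdsWithin_le_nhds
  refine ((((tendsto_rateToSIR_mul_div c).pow n).mul (h1.pow k)).mul
    (hZ.tendsto.comp h1)).congr fun τ => ?_
  rw [pow_add, div_pow, Function.comp_apply]
  ring

end SIR

/-- Comparison of a positive term of order `τ ^ n` with a negative one of order `τ ^ m`. For
`n = m` the leading coefficients may cancel, and analyticity decides. -/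
theorem eventually_sign_sub {c₁ c₂ C D : ℝ} (hc₁ : 0 < c₁) (hc₂ : 0 < c₂) (hC : 0 < C) (hD : 0 < D)
    {X Y : ℝ → ℝ} (hX : AnalyticAt ℝ X 0) (hY : AnalyticAt ℝ Y 0) (hX0 : 0 < X 0) (hY0 : 0 < Y 0)
    (m n : ℕ) :
    let f : ℝ → ℝ := fun τ => D * (rateToSIR (c₂ * τ) ^ n * Y (rateToSIR (c₂ * τ))) -
      C * (rateToSIR (c₁ * τ) ^ m * X (rateToSIR (c₁ * τ)))
    (n < m → ∀ᶠ τ in 𝓝[>] (0 : ℝ), 0 < f τ) ∧ (m < n → ∀ᶠ τ in 𝓝[>] (0 : ℝ), f τ < 0) ∧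
      ((∀ᶠ τ in 𝓝[>] (0 : ℝ), 0 < f τ) ∨ (∀ᶠ τ in 𝓝[>] (0 : ℝ), f τ = 0) ∨
        ∀ᶠ τ in 𝓝[>] (0 : ℝ), f τ < 0) := by
  intro f
  have hlog : 0 < Real.log 2 := Real.log_pos one_lt_two
  refine ⟨fun h => ?_, fun h => ?_, eventually_sign_of_analyticAt ?_⟩
  · obtain ⟨k, rfl⟩ := Nat.exists_eq_add_of_lt h
    have hlim := ((tendsto_rateToSIR_pow_mul_div hc₂ hY.continuousAt n 0).const_mul D).sub
      ((tendsto_rateToSIR_pow_mul_div hc₁ hX.continuousAt n (k + 1)).const_mul C)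
    filter_upwards [hlim.eventually_const_lt (u := 0) (by
      simp only [pow_zero, mul_one, zero_pow (Nat.succ_ne_zero k), mul_zero, zero_mul, sub_zero]
      positivity), self_mem_nhdsWithin] with τ h1 (h2 : 0 < τ)
    rw [← mul_div_assoc, ← mul_div_assoc, ← sub_div] at h1
    exact (div_pos_iff_of_pos_right (pow_pos h2 n)).1 h1
  · obtain ⟨k, rfl⟩ := Nat.exists_eq_add_of_lt h
    have hlim := ((tendsto_rateToSIR_pow_mul_div hc₂ hY.continuousAt m (k + 1)).const_mul D).sub
      ((tendsto_rateToSIR_pow_mul_div hc₁ hX.continuousAt m 0).const_mul C)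
    filter_upwards [hlim.eventually_lt_const (u := 0) (by
      simp only [pow_zero, mul_one, zero_pow (Nat.succ_ne_zero k), mul_zero, zero_mul, zero_sub]
      exact neg_neg_of_pos (by positivity)), self_mem_nhdsWithin] with τ h1 (h2 : 0 < τ)
    rw [← mul_div_assoc, ← mul_div_assoc, ← sub_div] at h1
    exact lt_of_not_ge fun hcon => h1.not_ge (div_nonneg hcon (pow_pos h2 m).le)
  · have comp : ∀ {Z : ℝ → ℝ} (c : ℝ), AnalyticAt ℝ Z 0 →
        AnalyticAt ℝ (fun τ => Z (rateToSIR (c * τ))) 0 := fun c hZ =>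
      hZ.comp_of_eq (analyticAt_rateToSIR_mul c) (by simp [rateToSIR_zero])
    exact (analyticAt_const.mul (((analyticAt_rateToSIR_mul c₂).pow n).mul (comp c₂ hY))).sub
      (analyticAt_const.mul (((analyticAt_rateToSIR_mul c₁).pow m).mul (comp c₁ hX)))

namespace Params

variable (H : Params)

/-! ### The increments of the rate coverage probability -/

theorem meanLoad1_pos : 0 < H.meanLoad1 := by
  have h1 := H.A1_pos
  have h2 := H.lam1_pos
  have h3 := H.lamu_pos
  unfold meanLoad1
  positivity

theorem meanLoad2_pos : 0 < H.meanLoad2 := by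
  have h1 := H.A2_pos
  have h2 := H.lam2_pos
  have h3 := H.lamu_pos
  unfold meanLoad2
  positivity

theorem rateCoverage_succ_sub {U : ℕ} (hU : U + 1 < H.N1) :
    ∀ᶠ τ in 𝓝[>] (0 : ℝ), H.rateCoverage (U + 1) τ - H.rateCoverage U τ =
      H.A2O * (H.prSelected (U + 1) - H.prSelected U) *
        (rateToSIR (H.meanLoad2 / H.W * τ) ^ H.N2 *
          ∑ n ∈ Finset.range H.N2, H.offGeometry.coverMean H n (H.N2 - n)
            (rateToSIR (H.meanLoad2 / H.W * τ))) -
      H.A1 * H.pmfNulled (U + 1) (U + 1) *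
        (rateToSIR (H.meanLoad1 / H.W * τ) ^ (H.N1 - (U + 1)) *
          H.macroGeometry.coverMean H (H.N1 - (U + 1)) 0
            (rateToSIR (H.meanLoad1 / H.W * τ))) := by
  filter_upwards [(tendsto_rateToSIR_mul (div_pos H.meanLoad1_pos H.W_pos)).eventually
    (H.S1_succ_sub hU), (tendsto_rateToSIR_mul (div_pos H.meanLoad2_pos H.W_pos)).eventually
    H.S2OC_sub_S2OCbar] with τ h1 h2
  rw [rateCoverage, rateCoverage, mul_div_right_comm, mul_div_right_comm]
  linear_combination H.A1 * h1 + H.A2O * (H.prSelected (U + 1) - H.prSelected U) * h2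

/-- The gain of the offloaded users has order `τ ^ N2`, the loss of the macro-users has order
`τ ^ (N1 - (U + 1))`. -/
theorem rateCoverage_sign {U : ℕ} (hU : U + 1 < H.N1) :
    (U + 1 + H.N2 < H.N1 →
      ∀ᶠ τ in 𝓝[>] (0 : ℝ), H.rateCoverage U τ < H.rateCoverage (U + 1) τ) ∧
    (H.N1 < U + 1 + H.N2 →
      ∀ᶠ τ in 𝓝[>] (0 : ℝ), H.rateCoverage (U + 1) τ < H.rateCoverage U τ) ∧
    ((∀ᶠ τ in 𝓝[>] (0 : ℝ), H.rateCoverage U τ < H.rateCoverage (U + 1) τ) ∨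
      (∀ᶠ τ in 𝓝[>] (0 : ℝ), H.rateCoverage (U + 1) τ = H.rateCoverage U τ) ∨
      ∀ᶠ τ in 𝓝[>] (0 : ℝ), H.rateCoverage (U + 1) τ < H.rateCoverage U τ) := by
  have key := eventually_sign_sub (div_pos H.meanLoad1_pos H.W_pos)
    (div_pos H.meanLoad2_pos H.W_pos) (mul_pos H.A1_pos (H.pmfNulled_self_pos (U + 1)))
    (mul_pos H.A2O_pos (sub_pos.2 (H.prSelected_lt_succ U)))
    (H.macroGeometry.analyticAt_coverMean H (H.N1 - (U + 1)) 0)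
    (Y := fun β => ∑ n ∈ Finset.range H.N2, H.offGeometry.coverMean H n (H.N2 - n) β)
    (Finset.analyticAt_fun_sum _ fun n _ => H.offGeometry.analyticAt_coverMean H n (H.N2 - n))
    (H.macroGeometry.coverMean_zero_pos H (H.N1 - (U + 1)) 0)
    (Finset.sum_pos (fun n _ => H.offGeometry.coverMean_zero_pos H n (H.N2 - n))
      ⟨0, Finset.mem_range.2 H.N2_pos⟩) (H.N1 - (U + 1)) H.N2
  have hd := H.rateCoverage_succ_sub hU
  have hpos := fun h : ∀ᶠ τ in 𝓝[>] (0 : ℝ), 0 < _ => (hd.and h).mono fun τ ⟨h1, h2⟩ =>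
    sub_pos.1 (h2.trans_eq h1.symm)
  have hneg := fun h : ∀ᶠ τ in 𝓝[>] (0 : ℝ), _ < 0 => (hd.and h).mono fun τ ⟨h1, h2⟩ =>
    sub_neg.1 (h1.trans_lt h2)
  exact ⟨fun h => hpos (key.1 (by omega)), fun h => hneg (key.2.1 (by omega)),
    key.2.2.imp hpos (Or.imp (fun h => (hd.and h).mono fun τ ⟨h1, h2⟩ =>
      sub_eq_zero.1 (h1.trans h2)) hneg)⟩

theorem argmaxU_eventually_eq {a b : ℕ} (hab : a ≤ b) (hb : b < H.N1)
    (hinc : ∀ U < a, ∀ᶠ τ in 𝓝[>] (0 : ℝ), H.rateCoverage U τ < H.rateCoverage (U + 1) τ)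
    (hconst : ∀ U, a ≤ U → U < b →
      ∀ᶠ τ in 𝓝[>] (0 : ℝ), H.rateCoverage (U + 1) τ = H.rateCoverage U τ)
    (hdec : ∀ U, b ≤ U → U + 1 < H.N1 →
      ∀ᶠ τ in 𝓝[>] (0 : ℝ), H.rateCoverage (U + 1) τ < H.rateCoverage U τ) :
    ∀ᶠ τ in 𝓝[>] (0 : ℝ), H.argmaxU τ = Set.Icc a b := by
  have hinc' := (Finset.eventually_all (Finset.range a)).2 fun U hU =>
    hinc U (Finset.mem_range.1 hU)
  have hconst' := (Finset.eventually_all (Finset.Ico a b)).2 fun U hU =>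
    hconst U (Finset.mem_Ico.1 hU).1 (Finset.mem_Ico.1 hU).2
  have hdec' := (Finset.eventually_all (Finset.Ico b (H.N1 - 1))).2 fun U hU =>
    hdec U (Finset.mem_Ico.1 hU).1 (by have := (Finset.mem_Ico.1 hU).2; omega)
  filter_upwards [hinc', hconst', hdec'] with τ h1 h2 h3
  exact setOf_isMax_eq_Icc (fun U => H.rateCoverage U τ) hab hb
    (fun U hU => h1 U (Finset.mem_range.2 hU))
    (fun U hU hU' => h2 U (Finset.mem_Ico.2 ⟨hU, hU'⟩))
    fun U hU hU' => h3 U (Finset.mem_Ico.2 ⟨hU, by omega⟩)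

/-- For small `τ` the step from `U` to `U + 1` is a gain if `U + 1 < N1 - N2` and a loss if
`U + 1 > N1 - N2`. For `U + 1 = N1 - N2` its sign depends on the parameters, but not on `τ`. -/
theorem exists_argmaxU_eventually_eq (hN : H.N2 ≤ H.N1) :
    ∃ a b : ℕ, a ≤ b ∧ b ≤ H.N1 - H.N2 ∧ H.N1 - H.N2 ≤ a + 1 ∧
      ∀ᶠ τ in 𝓝[>] (0 : ℝ), H.argmaxU τ = Set.Icc a b := by
  have hN2 := H.N2_pos
  have inc : ∀ U, U + 1 < H.N1 - H.N2 →
      ∀ᶠ τ in 𝓝[>] (0 : ℝ), H.rateCoverage U τ < H.rateCoverage (U + 1) τ := fun U hU =>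
    (H.rateCoverage_sign (by omega)).1 (by omega)
  have dec : ∀ U, H.N1 - H.N2 ≤ U → U + 1 < H.N1 →
      ∀ᶠ τ in 𝓝[>] (0 : ℝ), H.rateCoverage (U + 1) τ < H.rateCoverage U τ := fun U hU hU' =>
    (H.rateCoverage_sign hU').2.1 (by omega)
  rcases Nat.eq_zero_or_pos (H.N1 - H.N2) with hk | hk
  · exact ⟨0, 0, le_rfl, Nat.zero_le _, by omega, H.argmaxU_eventually_eq le_rfl H.N1_pos
      (fun U hU => by omega) (fun U hU hU' => by omega) fun U hU => dec U (by omega)⟩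
  obtain ⟨j, hj⟩ := Nat.exists_eq_add_of_le' hk
  rcases (H.rateCoverage_sign (U := j) (by omega)).2.2 with h | h | h
  · refine ⟨j + 1, j + 1, le_rfl, by omega, by omega, H.argmaxU_eventually_eq le_rfl (by omega)
      (fun U hU => ?_) (fun U hU hU' => by omega) fun U hU => dec U (by omega)⟩
    rcases (Nat.lt_succ_iff.1 hU).lt_or_eq with h' | rfl
    · exact inc U (by omega)
    · exact h
  · refine ⟨j, j + 1, Nat.le_succ j, by omega, by omega, H.argmaxU_eventually_eq (Nat.le_succ j)
      (by omega) (fun U hU => inc U (by omega)) (fun U hU hU' => ?_) fun U hU => dec U (by omega)⟩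
    obtain rfl : U = j := by omega
    exact h
  · refine ⟨j, j, le_rfl, by omega, by omega, H.argmaxU_eventually_eq le_rfl (by omega)
      (fun U hU => inc U (by omega)) (fun U hU hU' => by omega) fun U hU hU' => ?_⟩
    rcases hU.eq_or_lt with rfl | h'
    · exact h
    · exact dec U (by omega) hU'

end Params

end HetNet

theorem theorem2 (H : HetNet.Params) (hN : H.N2 ≤ H.N1) :
    ∃ (U₀ : ℕ) (S : Set ℕ),
      ((U₀ : ℤ) = (H.N1 : ℤ) - H.N2 - 1 ∨ (U₀ : ℤ) = (H.N1 : ℤ) - H.N2) ∧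
      Filter.Tendsto H.optU (nhdsWithin 0 (Set.Ioi 0)) (nhds U₀) ∧
      (∀ U ∈ S, (U : ℤ) = (H.N1 : ℤ) - H.N2 - 1 ∨ (U : ℤ) = (H.N1 : ℤ) - H.N2) ∧
      (∀ᶠ τ in nhdsWithin (0 : ℝ) (Set.Ioi 0), H.argmaxU τ = S) := by
  obtain ⟨a, b, hab, hb, ha, hev⟩ := H.exists_argmaxU_eventually_eq hN
  refine ⟨a, Set.Icc a b, by omega, ?_, fun U hU => ?_, hev⟩
  · refine tendsto_const_nhds.congr' ?_
    filter_upwards [hev] with τ hτ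
    rw [HetNet.Params.optU, hτ, csInf_Icc hab]
  · have h1 := hU.1
    have h2 := hU.2
    omega
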